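/- Let $M$ be a smooth manifold of dimension $2m$ with a smooth pseudo-Riemannian metric $g$ of arbitrary signature, and let $D\subset T_{\mathbb C}M=\mathbb C\otimes TM$ be a maximal isotropic distribution, i.e. a smooth complex subbundle of rank $m$ on which the complex-bilinear extension of $g$ vanishes. Suppose that $D$ is integrable, $[D,D]\subset D$. (1) Suppose that $M$, $g$ and $D$ are real-analytic. Let $X$ be a complexification of $M$, that is, a complex manifold in which $M$ is real-analytically embedded so that $\mathbb C\otimes T_pM\to T_pX$ is an isomorphism for every $p\in M$, and such that every connected component of $X$ meets $M$. Let $g_{\mathbb C}$ be a holomorphic metric on $X$ (a nondegenerate symmetric holomorphic $2$-tensor) extending $g$, and let $D_{\mathbb C}\subset TX$ be a holomorphic distribution of rank $m$ extending $D$. Then every (immersed) integral surface $f:N\to X$ of $D_{\mathbb C}$ is totally geodesic: every holomorphic geodesic $\gamma$ of $g_{\mathbb C}$ with complex affine parameter that is tangent to $N$ at one point, $\gamma(0)=f(q)$ and $\gamma'(0)\in df(T_qN)$, remains in $N$ near that point, i.e. $\gamma=f\circ c$ near $0$ for a holomorphic curve germ $c$ in $N$ with $c(0)=q$. (2) Suppose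 that $g$ has Lorentzian signature. Then $D\cap\overline D$ is a complex line bundle, spanned locally by a nowhere vanishing smooth real null vector field, and the null congruence it defines is geodesic: every regular $C^2$ curve $\gamma$ in $M$ with $\gamma'\in D\cap\overline D$ is a geodesic up to parametrisation, $\nabla_{\gamma'}\gamma'=a\,\gamma'$ for some function $a$, where $\nabla$ is the Levi-Civita connection of $g$. -/

import Mathlib

open scoped Manifold ContDiff Topology TensorProduct

noncomputable section

namespace IsotropicFoliation

/-! ### Pseudo-Riemannian metrics over `ℝ` and holomorphic metrics over `ℂ` -/

section Metric

variable {𝕜 : Type*} [RCLike 𝕜] {E : Type*} [NormedAddCommGroup E] [NormedSpace 𝕜 E]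
  {M : Type*} [TopologicalSpace M] [ChartedSpace E M]

/-- The coefficients of a covariant `2`-tensor field `g` in the preferred chart at `p`: the pullback
of `g` by the inverse of that chart. -/
def inChart (g : ∀ x : M, TangentSpace 𝓘(𝕜, E) x →L[𝕜] TangentSpace 𝓘(𝕜, E) x →L[𝕜] 𝕜)
    (p : M) (y : E) : E →L[𝕜] E →L[𝕜] 𝕜 :=
  let φ := extChartAt 𝓘(𝕜, E) p
  let A : E →L[𝕜] E := mfderiv 𝓘(𝕜, E) 𝓘(𝕜, E) φ.symm y
  let G : E →L[𝕜] E →L[𝕜] 𝕜 := g (φ.symm y)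
  G.bilinearComp A A

/-- `g` is a nondegenerate symmetric `2`-tensor field of class `C^n` over `𝕜`. For `𝕜 = ℝ` this is a
pseudo-Riemannian metric of arbitrary signature (real-analytic if `n = ω`); for `𝕜 = ℂ` and `n = ω`
it is a holomorphic metric. -/
structure IsMetric (n : WithTop ℕ∞)
    (g : ∀ x : M, TangentSpace 𝓘(𝕜, E) x →L[𝕜] TangentSpace 𝓘(𝕜, E) x →L[𝕜] 𝕜) : Prop where
  symm : ∀ x u v, g x u v = g x v u
  nondegenerate : ∀ x u, (∀ v, g x u v = 0) → u = 0
  contDiffOn : ∀ p : M, ContDiffOn 𝕜 n (inChart g p) (extChartAt 𝓘(𝕜, E) p).target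

/-- The Christoffel symbols of the first kind of the Levi-Civita connection of a metric `G` on (an
open part of) `E`, that is `G (∇_u v, w)` for constant vector fields `u`, `v`, `w`. -/
def christoffel (G : E → E →L[𝕜] E →L[𝕜] 𝕜) (y u v w : E) : 𝕜 :=
  2⁻¹ * (fderiv 𝕜 G y u v w + fderiv 𝕜 G y v u w - fderiv 𝕜 G y w u v)

/-- `g (∇_{c'} c', w)` at parameter `t`, where `c` is the expression of the curve `γ` in the
preferred chart at `p` and `∇` is the Levi-Civita connection of `g`. As `g` is nondegenerate, these
numbers determine the covariant acceleration `∇_{c'} c'`. -/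
def acceleration (g : ∀ x : M, TangentSpace 𝓘(𝕜, E) x →L[𝕜] TangentSpace 𝓘(𝕜, E) x →L[𝕜] 𝕜)
    (p : M) (γ : 𝕜 → M) (t : 𝕜) (w : E) : 𝕜 :=
  let c : 𝕜 → E := fun s => extChartAt 𝓘(𝕜, E) p (γ s)
  inChart g p (c t) (deriv (deriv c) t) w
    + christoffel (inChart g p) (c t) (deriv c t) (deriv c t) w

/-- Near the parameter `t₀` the curve `γ` is an (affinely parametrised) geodesic: `∇_{γ'} γ' = 0`.
For `𝕜 = ℂ` the parameter is complex and `γ` is holomorphic. -/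
def IsGeodesicAt (g : ∀ x : M, TangentSpace 𝓘(𝕜, E) x →L[𝕜] TangentSpace 𝓘(𝕜, E) x →L[𝕜] 𝕜)
    (γ : 𝕜 → M) (t₀ : 𝕜) : Prop :=
  ContMDiffAt 𝓘(𝕜, 𝕜) 𝓘(𝕜, E) 2 γ t₀ ∧
    ∀ᶠ t in 𝓝 t₀, ∀ w : E, acceleration g (γ t₀) γ t w = 0

/-- Near the parameter `t₀` the curve `γ` is a geodesic up to parametrisation: `γ' ≠ 0` and
`∇_{γ'} γ'` is proportional to `γ'`. -/
def IsUnparametrizedGeodesicAt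
    (g : ∀ x : M, TangentSpace 𝓘(𝕜, E) x →L[𝕜] TangentSpace 𝓘(𝕜, E) x →L[𝕜] 𝕜)
    (γ : 𝕜 → M) (t₀ : 𝕜) : Prop :=
  ContMDiffAt 𝓘(𝕜, 𝕜) 𝓘(𝕜, E) 2 γ t₀ ∧
    mfderiv 𝓘(𝕜, 𝕜) 𝓘(𝕜, E) γ t₀ ≠ 0 ∧
    ∀ᶠ t in 𝓝 t₀, ∃ a : 𝕜, ∀ w : E, acceleration g (γ t₀) γ t w =
      a * inChart g (γ t₀) (extChartAt 𝓘(𝕜, E) (γ t₀) (γ t))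
        (deriv (fun s => extChartAt 𝓘(𝕜, E) (γ t₀) (γ s)) t) w

variable {E' : Type*} [NormedAddCommGroup E'] [NormedSpace 𝕜 E']
  {N : Type*} [TopologicalSpace N] [ChartedSpace E' N]

/-- The immersed submanifold `f : N → M` is totally geodesic: every geodesic of `M` that is tangent
to it at one parameter value stays in it for nearby parameter values. -/
def IsTotallyGeodesic
    (g : ∀ x : M, TangentSpace 𝓘(𝕜, E) x →L[𝕜] TangentSpace 𝓘(𝕜, E) x →L[𝕜] 𝕜)
    (f : N → M) : Prop :=
  ∀ (γ : 𝕜 → M) (q : N) (u : TangentSpace 𝓘(𝕜, E') q), IsGeodesicAt g γ 0 →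
    tangentMap 𝓘(𝕜, 𝕜) 𝓘(𝕜, E) γ ⟨0, (1 : 𝕜)⟩ = tangentMap 𝓘(𝕜, E') 𝓘(𝕜, E) f ⟨q, u⟩ →
    ∃ c : 𝕜 → N, c 0 = q ∧ ContMDiffAt 𝓘(𝕜, 𝕜) 𝓘(𝕜, E') 2 c 0 ∧ ∀ᶠ t in 𝓝 0, f (c t) = γ t

/-- The map `f : N → M` is an (immersed) integral manifold of the distribution `D` on `M`. -/
structure IsIntegralManifold (D : ∀ x : M, Submodule 𝕜 (TangentSpace 𝓘(𝕜, E) x))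
    (f : N → M) : Prop where
  contMDiff : ContMDiff 𝓘(𝕜, E') 𝓘(𝕜, E) ω f
  injective : ∀ q, Function.Injective (mfderiv 𝓘(𝕜, E') 𝓘(𝕜, E) f q)
  range_eq : ∀ q, (mfderiv 𝓘(𝕜, E') 𝓘(𝕜, E) f q).range = D (f q)

/-- `D` is a subbundle of rank `m` and class `C^n` of the tangent bundle of `M`. -/
def IsDistribution [IsManifold 𝓘(𝕜, E) 1 M] (n : WithTop ℕ∞) (m : ℕ)
    (D : ∀ x : M, Submodule 𝕜 (TangentSpace 𝓘(𝕜, E) x)) : Prop :=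
  ∀ p : M, ∃ (U : Set M) (V : Fin m → ∀ x : M, TangentSpace 𝓘(𝕜, E) x), IsOpen U ∧ p ∈ U ∧
    (∀ i, ContMDiffOn 𝓘(𝕜, E) 𝓘(𝕜, E).tangent n
      (fun x => (⟨x, V i x⟩ : TangentBundle 𝓘(𝕜, E) M)) U) ∧
    ∀ x ∈ U, LinearIndependent 𝕜 (fun i => V i x) ∧
      D x = Submodule.span 𝕜 (Set.range fun i => V i x)

end Metric

/-! ### The complexified tangent bundle of a real manifold -/

section Linear

variable {V : Type*} [AddCommGroup V] [Module ℝ V]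

/-- The complex vector `a + i b`. -/
def complexVector (a b : V) : ℂ ⊗[ℝ] V := (1 : ℂ) ⊗ₜ[ℝ] a + Complex.I ⊗ₜ[ℝ] b

/-- Complex conjugation on the complexification of a real vector space. -/
def conjugation (V : Type*) [AddCommGroup V] [Module ℝ V] : ℂ ⊗[ℝ] V →ₗ[ℝ] ℂ ⊗[ℝ] V :=
  LinearMap.rTensor V Complex.conjAe.toLinearMap

theorem conjugation_smul (c : ℂ) (z : ℂ ⊗[ℝ] V) :
    conjugation V (c • z) = (starRingEnd ℂ) c • conjugation V z := by
  induction z using TensorProduct.induction_on with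
  | zero => simp
  | tmul a v => simp [conjugation, TensorProduct.smul_tmul']
  | add x y hx hy => simp only [smul_add, map_add, hx, hy]

/-- The complex conjugate of a complex subspace of the complexification. -/
def conjugate (D : Submodule ℂ (ℂ ⊗[ℝ] V)) : Submodule ℂ (ℂ ⊗[ℝ] V) where
  carrier := {z | conjugation V z ∈ D}
  zero_mem' := by simp
  add_mem' := by
    intro x y hx hy
    simpa using D.add_mem hx hy
  smul_mem' := by
    intro c x hx
    simpa [conjugation_smul] using D.smul_mem _ hx

/-- The complex-bilinear extension of a real bilinear form vanishes on `D`. -/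
def IsIsotropic (b : LinearMap.BilinForm ℝ V) (D : Submodule ℂ (ℂ ⊗[ℝ] V)) : Prop :=
  ∀ v ∈ D, ∀ w ∈ D, b.baseChange ℂ v w = 0

/-- `b` has Lorentzian signature `(1, n - 1)` or `(n - 1, 1)`. -/
def IsLorentzian (b : LinearMap.BilinForm ℝ V) : Prop :=
  let Q : QuadraticForm ℝ V := LinearMap.BilinMap.toQuadraticMap b
  (sigPos Q = 1 ∧ sigNeg Q + 1 = Module.finrank ℝ V) ∨
    (sigNeg Q = 1 ∧ sigPos Q + 1 = Module.finrank ℝ V)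

end Linear

section RealManifold

variable {E : Type*} [NormedAddCommGroup E] [NormedSpace ℝ E]
  {M : Type*} [TopologicalSpace M] [ChartedSpace E M]

/-- The value at `x` of a real metric, as a bilinear form. -/
def bilin (g : ∀ x : M, TangentSpace 𝓘(ℝ, E) x →L[ℝ] TangentSpace 𝓘(ℝ, E) x →L[ℝ] ℝ) (x : M) :
    LinearMap.BilinForm ℝ (TangentSpace 𝓘(ℝ, E) x) :=
  LinearMap.mk₂ ℝ (fun u v => g x u v) (by simp) (by simp) (by simp) (by simp)

/-- `D` is a subbundle of complex rank `m` and class `C^n` of the complexified tangent bundle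
`ℂ ⊗ TM`: near every point it has a frame `A i + √-1 B i` with `A i`, `B i` real vector fields of
class `C^n`. -/
def IsComplexDistribution [IsManifold 𝓘(ℝ, E) 1 M] (n : WithTop ℕ∞) (m : ℕ)
    (D : ∀ x : M, Submodule ℂ (ℂ ⊗[ℝ] TangentSpace 𝓘(ℝ, E) x)) : Prop :=
  ∀ p : M, ∃ (U : Set M) (A B : Fin m → ∀ x : M, TangentSpace 𝓘(ℝ, E) x), IsOpen U ∧ p ∈ U ∧
    (∀ i, ContMDiffOn 𝓘(ℝ, E) 𝓘(ℝ, E).tangent n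
      (fun x => (⟨x, A i x⟩ : TangentBundle 𝓘(ℝ, E) M)) U) ∧
    (∀ i, ContMDiffOn 𝓘(ℝ, E) 𝓘(ℝ, E).tangent n
      (fun x => (⟨x, B i x⟩ : TangentBundle 𝓘(ℝ, E) M)) U) ∧
    ∀ x ∈ U, LinearIndependent ℂ (fun i => complexVector (A i x) (B i x)) ∧
      D x = Submodule.span ℂ (Set.range fun i => complexVector (A i x) (B i x))

/-- The Frobenius condition `[D, D] ⊆ D` for local smooth sections `A₁ + i B₁`, `A₂ + i B₂` of a
distribution in the complexified tangent bundle, with the complex-bilinear Lie bracket. -/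
def IsIntegrable [IsManifold 𝓘(ℝ, E) 1 M]
    (D : ∀ x : M, Submodule ℂ (ℂ ⊗[ℝ] TangentSpace 𝓘(ℝ, E) x)) : Prop :=
  ∀ (U : Set M) (A₁ B₁ A₂ B₂ : ∀ x : M, TangentSpace 𝓘(ℝ, E) x), IsOpen U →
    (∀ V ∈ [A₁, B₁, A₂, B₂], ContMDiffOn 𝓘(ℝ, E) 𝓘(ℝ, E).tangent ∞
      (fun x => (⟨x, V x⟩ : TangentBundle 𝓘(ℝ, E) M)) U) →
    (∀ x ∈ U, complexVector (A₁ x) (B₁ x) ∈ D x ∧ complexVector (A₂ x) (B₂ x) ∈ D x) →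
    ∀ x ∈ U, complexVector
      (VectorField.mlieBracket 𝓘(ℝ, E) A₁ A₂ x - VectorField.mlieBracket 𝓘(ℝ, E) B₁ B₂ x)
      (VectorField.mlieBracket 𝓘(ℝ, E) A₁ B₂ x + VectorField.mlieBracket 𝓘(ℝ, E) B₁ A₂ x) ∈ D x

/-! ### Complexification of a real-analytic manifold -/

variable {F : Type*} [NormedAddCommGroup F] [NormedSpace ℂ F]
  {X : Type*} [TopologicalSpace X] [ChartedSpace F X]

/-- The complex-linear extension `ℂ ⊗ T_p M → T_{ι p} X` of the real differential of a map `ι` from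
a real manifold to a complex manifold. -/
def complexDifferential (ι : M → X) (p : M) :
    ℂ ⊗[ℝ] TangentSpace 𝓘(ℝ, E) p →ₗ[ℂ] TangentSpace 𝓘(ℂ, F) (ι p) :=
  let A : TangentSpace 𝓘(ℝ, E) p →L[ℝ] F := mfderiv 𝓘(ℝ, E) 𝓘(ℝ, F) ι p
  let B : ℂ ⊗[ℝ] TangentSpace 𝓘(ℝ, E) p →ₗ[ℂ] F := LinearMap.liftBaseChange ℂ A.toLinearMap
  B

/-- `ι : M → X` exhibits the complex manifold `X` as a complexification of the real-analytic manifold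
`M`: a real-analytic embedding onto a maximally totally real submanifold of `X`. As usual `X` is only
a neighbourhood of `M`, so that all its components meet `M`. -/
structure IsComplexification (ι : M → X) : Prop where
  isEmbedding : Topology.IsEmbedding ι
  analytic : ContMDiff 𝓘(ℝ, E) 𝓘(ℝ, F) ω ι
  bijective : ∀ p, Function.Bijective (complexDifferential (E := E) (F := F) ι p)
  meets : ∀ x, ∃ p, ι p ∈ connectedComponent x

/-- The complex-bilinear tensor field `gc` on `X` restricts to the real tensor field `g` on `M`. -/
def ExtendsMetric (ι : M → X)
    (g : ∀ x : M, TangentSpace 𝓘(ℝ, E) x →L[ℝ] TangentSpace 𝓘(ℝ, E) x →L[ℝ] ℝ)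
    (gc : ∀ x : X, TangentSpace 𝓘(ℂ, F) x →L[ℂ] TangentSpace 𝓘(ℂ, F) x →L[ℂ] ℂ) : Prop :=
  ∀ p, ∀ u v : TangentSpace 𝓘(ℝ, E) p,
    gc (ι p) (complexDifferential ι p ((1 : ℂ) ⊗ₜ[ℝ] u)) (complexDifferential ι p ((1 : ℂ) ⊗ₜ[ℝ] v))
      = (g p u v : ℂ)

/-- The distribution `Dc` on `X` restricts to `D` on `M`. -/
def ExtendsDistribution (ι : M → X)
    (D : ∀ x : M, Submodule ℂ (ℂ ⊗[ℝ] TangentSpace 𝓘(ℝ, E) x))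
    (Dc : ∀ x : X, Submodule ℂ (TangentSpace 𝓘(ℂ, F) x)) : Prop :=
  ∀ p, Dc (ι p) = (D p).map (complexDifferential ι p)

end RealManifold

end IsotropicFoliation

end

open scoped Manifold ContDiff Topology TensorProduct

noncomputable section

namespace IsotropicFoliation

/-! Everything rests on the Koszul formula and on the fact that a maximal isotropic subspace is its
own orthogonal.

Analytic case. Isotropy of the holomorphic distribution is locally the vanishing of finitely many
holomorphic functions. They vanish on the maximally totally real `M`, hence near it, and the
identity theorem carries this over the components of `X`, all of which meet `M`
(`isotropic_of_isComplexification`). On an integral surface, differentiating the isotropy relation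
gives g(∇_u v, w) = 0 for tangent u, v, w (`secondFundamentalForm_eq_zero`), so ∇_u v is tangent. A
geodesic tangent to the surface is then shown to stay in it without solving the geodesic equation
inside the surface. Write it as ψ(c) + k with k in a complement of the tangent space. Pairing the
geodesic equation with tangent vectors, a nondegenerate pairing on the complement, gives |k''| ≤ C
|(k, k')|, because the remaining terms vanish when k = k' = 0. Grönwall then yields k = 0
(`exists_lift_of_acceleration_eq_zero`).

Lorentzian case. Let R be the real vectors in D and Re D the real parts. The kernel of Re on D is
iR, so the dimensions of R and Re D add up to dim V; as R ⊥ Re D, the orthogonal of Re D is R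
(`orthogonal_map_rePart`). If R were 0, a vector t with g(t,t) of the exceptional sign would have t
+ ic in D, and t, c would span a definite plane of that sign. Conversely R is totally null, so it
misses a definite hyperplane and is at most a line. A Gram operator that is inverted explicitly
gives a smooth section k (`exists_null_field`). For w in the frame of Re D, g(∇_k k, w) = -g(k, [k,
w]) = 0 by integrability, so ∇_k k lies in R and is a multiple of k
(`exists_acceleration_null_field`); curves along k inherit this. -/

set_option maxSynthPendingDepth 3

/-! ### Isotropic immersions and a second-order uniqueness estimate -/

section NormedSpace

variable {𝕜 : Type*} [RCLike 𝕜] {E : Type*} [NormedAddCommGroup E] [NormedSpace 𝕜 E]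
  {E' : Type*} [NormedAddCommGroup E'] [NormedSpace 𝕜 E']

/-- If the image of the differential of `ψ` is isotropic for `G`, then the covariant derivatives of
vector fields tangent to `ψ` are orthogonal to the image of the differential. -/
theorem secondFundamentalForm_eq_zero {ψ : E' → E} {G : E → E →L[𝕜] E →L[𝕜] 𝕜} {y : E'}
    (hψ : ContDiffAt 𝕜 2 ψ y) (hG : DifferentiableAt 𝕜 G (ψ y)) (hsymm : ∀ x u v, G x u v = G x v u)
    (hiso : ∀ᶠ z in 𝓝 y, ∀ u v, G (ψ z) (fderiv 𝕜 ψ z u) (fderiv 𝕜 ψ z v) = 0) (u v w : E') :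
    G (ψ y) (fderiv 𝕜 (fderiv 𝕜 ψ) y u v) (fderiv 𝕜 ψ y w) +
      christoffel G (ψ y) (fderiv 𝕜 ψ y u) (fderiv 𝕜 ψ y v) (fderiv 𝕜 ψ y w) = 0 := by
  have h1 : DifferentiableAt 𝕜 ψ y := hψ.differentiableAt (by norm_num)
  have h2 : DifferentiableAt 𝕜 (fderiv 𝕜 ψ) y :=
    (hψ.fderiv_right (m := 1) (by norm_num)).differentiableAt (by norm_num)
  have hs : ∀ a b, fderiv 𝕜 (fderiv 𝕜 ψ) y a b = fderiv 𝕜 (fderiv 𝕜 ψ) y b a :=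
    hψ.isSymmSndFDerivAt (by simp)
  -- The derivative along `a` of the vanishing function `G(ψ)(dψ b, dψ c)`.
  have key : ∀ a b c : E', fderiv 𝕜 G (ψ y) (fderiv 𝕜 ψ y a) (fderiv 𝕜 ψ y b) (fderiv 𝕜 ψ y c) +
      G (ψ y) (fderiv 𝕜 (fderiv 𝕜 ψ) y a b) (fderiv 𝕜 ψ y c) +
      G (ψ y) (fderiv 𝕜 (fderiv 𝕜 ψ) y a c) (fderiv 𝕜 ψ y b) = 0 := by
    intro a b c
    have hb := h2.hasFDerivAt.clm_apply (hasFDerivAt_const b y)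
    have hc := h2.hasFDerivAt.clm_apply (hasFDerivAt_const c y)
    have hGψ : HasFDerivAt (fun z => G (ψ z)) (fderiv 𝕜 G (ψ y) ∘L fderiv 𝕜 ψ y) y :=
      hG.hasFDerivAt.comp y h1.hasFDerivAt
    have h := (hGψ.clm_apply hb).clm_apply hc
    have h0 := h.congr_of_eventuallyEq (f₁ := fun _ => (0 : 𝕜))
      (by filter_upwards [hiso] with z hz; exact (hz b c).symm)
    have := congrArg (fun L => L a) (h0.unique (hasFDerivAt_const (0 : 𝕜) y))
    simp at this
    rw [hsymm (ψ y) _ (fderiv 𝕜 ψ y b), ← this]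
    ring
  have k1 := key u v w
  have k2 := key v u w
  have k3 := key w u v
  -- Symmetry of the second derivative stands in for the vanishing of brackets of coordinate fields;
  -- the alternating sum below is then Koszul's.
  rw [hs v u] at k2
  rw [hs w u, hs w v] at k3
  unfold christoffel
  have two : (2 : 𝕜) ≠ 0 := by norm_num
  field_simp
  linear_combination k1 + k2 - k3

/-- Along each real ray `s ↦ s * z` the pair `(k, k')` starts at zero and satisfies a linear
first-order differential inequality, so Grönwall applies. Rays reduce the complex parameter to a
real one. -/
theorem eventually_eq_zero_of_norm_deriv_deriv_le {E : Type*} [NormedAddCommGroup E]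
    [NormedSpace ℂ E] {k : ℂ → E} {C : ℝ}
    (hk : ContDiffAt ℂ 2 k 0) (h0 : k 0 = 0) (h1 : deriv k 0 = 0)
    (hC : ∀ᶠ t in 𝓝 0, ‖deriv (deriv k) t‖ ≤ C * ‖(k t, deriv k t)‖) :
    ∀ᶠ t in 𝓝 0, k t = 0 := by
  have hev := hk.eventually (by norm_num)
  obtain ⟨r, hr, hball⟩ := Metric.eventually_nhds_iff_ball.1 (hev.and hC)
  filter_upwards [Metric.ball_mem_nhds (0 : ℂ) hr] with z hz
  have hmem : ∀ s ∈ Set.Icc (0 : ℝ) 1, (s : ℂ) * z ∈ Metric.ball (0 : ℂ) r := by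
    intro s hs
    simp only [mem_ball_zero_iff, norm_mul, Complex.norm_real, Real.norm_eq_abs] at hz ⊢
    rw [abs_of_nonneg hs.1]
    nlinarith [hs.2, norm_nonneg z]
  have hd : ∀ s ∈ Set.Icc (0 : ℝ) 1, HasDerivAt
      (fun s : ℝ => (k (s * z), deriv k (s * z)))
      (z • deriv k (s * z), z • deriv (deriv k) (s * z)) s := by
    intro s hs
    have hkz := (hball _ (hmem s hs)).1
    have hl : HasDerivAt (fun s : ℝ => (s : ℂ) * z) z s := by
      simpa using (Complex.ofRealCLM.hasDerivAt (x := s)).mul_const z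
    have hd1 : HasDerivAt k (deriv k (s * z)) (s * z) :=
      (hkz.differentiableAt (by norm_num)).hasDerivAt
    have hd2 : HasDerivAt (deriv k) (deriv (deriv k) (s * z)) (s * z) := by
      have : ContDiffAt ℂ 1 (deriv k) (s * z) := by
        have h := hkz.fderiv_right (m := 1) (by norm_num)
        exact h.clm_apply contDiffAt_const
      exact (this.differentiableAt (by norm_num)).hasDerivAt
    have hc1 : HasDerivAt (fun s : ℝ => k (s * z)) (z • deriv k (s * z)) s := hd1.scomp s hl
    have hc2 : HasDerivAt (fun s : ℝ => deriv k (s * z)) (z • deriv (deriv k) (s * z)) s :=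
      HasDerivAt.scomp (g₁ := deriv k) s hd2 hl
    exact hc1.prodMk hc2
  have hz' : (fun s : ℝ => (k (s * z), deriv k (s * z))) 1 = 0 := by
    -- The derivative of the pair is `z • (k', k'')`: the first entry is at most the norm `N` of the
    -- pair, the second at most `|C| * N`. The absolute value is needed since `C` has no sign.
    refine eq_zero_of_abs_deriv_le_mul_abs_self_of_eq_zero_right (a := 0) (b := 1)
      (K := ‖z‖ * (1 + |C|))
      (fun s hs => (hd s hs).continuousAt.continuousWithinAt)
      (fun s hs => (hd s ⟨hs.1, hs.2.le⟩).hasDerivWithinAt) (by simp [h0, h1])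
      (fun s hs => ?_) 1 (by simp)
    have hb := (hball _ (hmem s ⟨hs.1, hs.2.le⟩)).2
    rw [← Prod.smul_mk, norm_smul, mul_assoc]
    gcongr
    set N := ‖(k (s * z), deriv k (s * z))‖
    have hN : 0 ≤ N := norm_nonneg _
    have e1 : ‖deriv k (s * z)‖ ≤ N := le_max_right _ _
    have e2 : C * N ≤ |C| * N := by gcongr; exact le_abs_self C
    rw [Prod.norm_mk]
    refine max_le (e1.trans ?_) (hb.trans (e2.trans ?_)) <;> nlinarith [abs_nonneg C]
  simpa using congrArg Prod.fst hz'

theorem contDiffAt_deriv {x : 𝕜 → E} {t : 𝕜} (hx : ContDiffAt 𝕜 2 x t) :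
    ContDiffAt 𝕜 1 (deriv x) t :=
  (hx.fderiv_right (m := 1) (by norm_num)).clm_apply contDiffAt_const

/-- The second derivative of a curve in the image of an immersion. -/
theorem hasDerivAt_deriv_comp {ψ : E' → E} {c : 𝕜 → E'} {t : 𝕜} (hψ : ContDiffAt 𝕜 2 ψ (c t))
    (hc : ContDiffAt 𝕜 2 c t) :
    HasDerivAt (fun s => fderiv 𝕜 ψ (c s) (deriv c s))
      (fderiv 𝕜 (fderiv 𝕜 ψ) (c t) (deriv c t) (deriv c t) +
        fderiv 𝕜 ψ (c t) (deriv (deriv c) t)) t := by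
  have h2 : DifferentiableAt 𝕜 (fderiv 𝕜 ψ) (c t) :=
    (hψ.fderiv_right (m := 1) (by norm_num)).differentiableAt (by norm_num)
  have hc1 : HasDerivAt c (deriv c t) t := (hc.differentiableAt (by norm_num)).hasDerivAt
  have hc2 : HasDerivAt (deriv c) (deriv (deriv c) t) t :=
    ((contDiffAt_deriv hc).differentiableAt (by norm_num)).hasDerivAt
  exact (h2.hasFDerivAt.comp_hasDerivAt t hc1).clm_apply hc2

/-- The Christoffel symbols of the first kind as a linear form in the last argument. -/
def christoffelForm (G : E → E →L[𝕜] E →L[𝕜] 𝕜) (y u v : E) : E →L[𝕜] 𝕜 :=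
  (2⁻¹ : 𝕜) • (fderiv 𝕜 G y u v + fderiv 𝕜 G y v u - ((fderiv 𝕜 G y).flip u).flip v)

@[simp]
theorem christoffelForm_apply (G : E → E →L[𝕜] E →L[𝕜] 𝕜) (y u v w : E) :
    christoffelForm G y u v w = christoffel G y u v w := by
  simp [christoffelForm, christoffel]

theorem contDiffAt_christoffelForm {V : Type*} [NormedAddCommGroup V] [NormedSpace 𝕜 V]
    {G : E → E →L[𝕜] E →L[𝕜] 𝕜} {y u v : V → E} {p : V}
    (hG : ContDiffAt 𝕜 2 G (y p)) (hy : ContDiffAt 𝕜 1 y p) (hu : ContDiffAt 𝕜 1 u p)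
    (hv : ContDiffAt 𝕜 1 v p) :
    ContDiffAt 𝕜 1 (fun q => christoffelForm G (y q) (u q) (v q)) p := by
  have h : ContDiffAt 𝕜 1 (fun q => fderiv 𝕜 G (y q)) p :=
    (hG.fderiv_right (m := 1) (by norm_num)).comp p hy
  have hf : ContDiffAt 𝕜 1 (fun q => (fderiv 𝕜 G (y q)).flip (u q)) p :=
    ((ContinuousLinearMap.flipₗᵢ 𝕜 E E (E →L[𝕜] 𝕜)).contDiff.contDiffAt.comp p h).clm_apply hu
  have hf' : ContDiffAt 𝕜 1 (fun q => ((fderiv 𝕜 G (y q)).flip (u q)).flip (v q)) p :=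
    ((ContinuousLinearMap.flipₗᵢ 𝕜 E E 𝕜).contDiff.contDiffAt.comp p hf).clm_apply hv
  exact ((((h.clm_apply hu).clm_apply hv).add ((h.clm_apply hv).clm_apply hu)).sub hf').const_smul _

end NormedSpace

/-- Used twice: over `ℂ` with `R = S` isotropic of half dimension, and over `ℝ` for the real parts
and the real points of a maximal isotropic subspace. -/
theorem orthogonal_eq_of_finrank_add {K V : Type*} [Field K] [AddCommGroup V] [Module K V]
    [FiniteDimensional K V] {B : LinearMap.BilinForm K V} (hB : B.Nondegenerate)
    {R S : Submodule K V} (hS : S ≤ B.orthogonal R)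
    (hdim : Module.finrank K R + Module.finrank K S = Module.finrank K V) :
    B.orthogonal R = S := by
  refine (Submodule.eq_of_le_of_finrank_eq hS ?_).symm
  rw [LinearMap.BilinForm.finrank_orthogonal hB]
  omega

/-! ### Geodesics tangent to a maximal isotropic immersion -/

section Lift

variable {F : Type*} [NormedAddCommGroup F] [NormedSpace ℂ F]
  {F' : Type*} [NormedAddCommGroup F'] [NormedSpace ℂ F']

/-- The inverse function theorem for `(y, κ) ↦ ψ y + κ`, whose differential is bijective because `K`
is complementary to the range of `dψ`. It splits nearby points into a tangential and a transverse
component. -/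
theorem exists_straightening [FiniteDimensional ℂ F] [FiniteDimensional ℂ F'] {n : WithTop ℕ∞}
    (hn : n ≠ 0) {ψ : F' → F} {y : F'} (hψ : ContDiffAt ℂ n ψ y)
    (hinj : Function.Injective (fderiv ℂ ψ y)) {K : Submodule ℂ F}
    (hK : IsCompl (fderiv ℂ ψ y).range K) :
    ∃ s : F → F' × K, ContDiffAt ℂ n s (ψ y) ∧ s (ψ y) = (y, 0) ∧
      ∀ᶠ z in 𝓝 (ψ y), ψ (s z).1 + (s z).2 = z := by
  have : CompleteSpace (F' × K) := FiniteDimensional.complete ℂ _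
  have : CompleteSpace F := FiniteDimensional.complete ℂ _
  let Φ : F' × K → F := fun p => ψ p.1 + p.2
  let L : F' × K →L[ℂ] F :=
    (fderiv ℂ ψ y) ∘L ContinuousLinearMap.fst ℂ F' K + K.subtypeL ∘L ContinuousLinearMap.snd ℂ F' K
  have hL : ∀ p, L p = fderiv ℂ ψ y p.1 + p.2 := fun p => by simp [L]
  have hker : L.ker = ⊥ := by
    rw [LinearMap.ker_eq_bot']
    intro p hp
    have hp' : fderiv ℂ ψ y p.1 + p.2 = 0 := (hL p).symm.trans hp
    have h2 : (p.2 : F) ∈ (fderiv ℂ ψ y).range :=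
      ⟨-p.1, by simpa [neg_eq_iff_add_eq_zero] using hp'⟩
    have h0 : (p.2 : F) = 0 := Submodule.disjoint_def.1 hK.disjoint _ h2 p.2.2
    have h1 : fderiv ℂ ψ y p.1 = 0 := by simpa [h0] using hp'
    exact Prod.ext (hinj (by simpa using h1)) (by simpa using h0)
  have hrange : L.range = ⊤ := by
    rw [LinearMap.range_eq_top]
    intro z
    obtain ⟨a, ha, b, hb, rfl⟩ := Submodule.mem_sup.1 (hK.sup_eq_top ▸ Submodule.mem_top (x := z))
    obtain ⟨v, rfl⟩ := ha
    exact ⟨(v, ⟨b, hb⟩), hL _⟩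
  let e : (F' × K) ≃L[ℂ] F := ContinuousLinearEquiv.ofBijective L hker hrange
  have hΦ : ContDiffAt ℂ n Φ (y, 0) :=
    (ContDiffAt.comp (y, (0 : K)) (g := ψ) hψ contDiffAt_fst).add
      (K.subtypeL.contDiff.contDiffAt.comp _ contDiffAt_snd)
  have hd : HasFDerivAt Φ (e : (F' × K) →L[ℂ] F) (y, 0) := by
    have h1 : HasFDerivAt (fun p : F' × K => ψ p.1)
        ((fderiv ℂ ψ y) ∘L ContinuousLinearMap.fst ℂ F' K) (y, 0) :=
      HasFDerivAt.comp (y, (0 : K)) (g := ψ) (hψ.differentiableAt hn).hasFDerivAt hasFDerivAt_fst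
    have h2 : HasFDerivAt (fun p : F' × K => (p.2 : F))
        (K.subtypeL ∘L ContinuousLinearMap.snd ℂ F' K) (y, 0) :=
      K.subtypeL.hasFDerivAt.comp (y, (0 : K)) hasFDerivAt_snd
    exact h1.add h2
  have hy : Φ (y, 0) = ψ y := by simp [Φ]
  refine ⟨hΦ.localInverse hd hn, hy ▸ hΦ.to_localInverse hd hn, ?_, ?_⟩
  · rw [← hy]
    exact hΦ.localInverse_apply_image hd hn
  · rw [← hy]
    exact (hΦ.hasStrictFDerivAt' hd hn).eventually_right_inverse

theorem eventually_norm_le_of_injective {V K W : Type*} [TopologicalSpace V]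
    [NormedAddCommGroup K] [NormedSpace ℂ K] [FiniteDimensional ℂ K] [NormedAddCommGroup W]
    [NormedSpace ℂ W] {T : V → K →L[ℂ] W} {v : V} (hT : ContinuousAt T v)
    (hinj : Function.Injective (T v)) :
    ∃ C : ℝ, 0 ≤ C ∧ ∀ᶠ v' in 𝓝 v, ∀ κ, ‖κ‖ ≤ C * ‖T v' κ‖ := by
  obtain ⟨c, hc, hanti⟩ := (T v : K →ₗ[ℂ] W).exists_antilipschitzWith (LinearMap.ker_eq_bot.2 hinj)
  have hc' : (0 : ℝ) < c := hc
  refine ⟨2 * c, by positivity, ?_⟩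
  -- A perturbation of size `(2 * c)⁻¹` costs at most half of `‖κ‖`, whence the constant `2 * c`.
  have hnear : ∀ᶠ v' in 𝓝 v, ‖T v' - T v‖ < (2 * (c : ℝ))⁻¹ := by
    have := (hT.sub continuousAt_const (g := fun _ => T v)).norm
    have h := this.tendsto
    rw [Pi.sub_apply, sub_self, norm_zero] at h
    exact h.eventually_lt_const (by positivity)
  filter_upwards [hnear] with v' hv' κ
  have h1 : ‖κ‖ ≤ c * ‖T v κ‖ := by
    simpa using hanti.le_mul_dist κ 0
  have h2 : ‖T v κ‖ ≤ ‖T v' κ‖ + (2 * (c : ℝ))⁻¹ * ‖κ‖ := by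
    have h3 : ‖(T v' - T v) κ‖ ≤ (2 * (c : ℝ))⁻¹ * ‖κ‖ := (T v' - T v).le_of_opNorm_le hv'.le κ
    have h4 : T v κ = T v' κ - (T v' - T v) κ := by simp
    rw [h4]
    exact (norm_sub_le _ _).trans (by gcongr)
  have h5 : c * ((2 * (c : ℝ))⁻¹ * ‖κ‖) = ‖κ‖ / 2 := by field_simp
  nlinarith [mul_le_mul_of_nonneg_left h2 hc'.le]

/-- The tangential part of the geodesic operator along a curve near the image of an immersion. The
arguments are the position and the first two derivatives of the tangential component of the curve,
and the position and the velocity of its transverse component. -/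
def tangentialForce (ψ : F' → F) (G : F → F →L[ℂ] F →L[ℂ] ℂ) (K : Submodule ℂ F)
    (p : F' × F' × F' × K × K) : F' →L[ℂ] ℂ :=
  (G (ψ p.1 + p.2.2.2.1) (fderiv ℂ (fderiv ℂ ψ) p.1 p.2.1 p.2.1 + fderiv ℂ ψ p.1 p.2.2.1) +
    christoffelForm G (ψ p.1 + p.2.2.2.1) (fderiv ℂ ψ p.1 p.2.1 + p.2.2.2.2)
      (fderiv ℂ ψ p.1 p.2.1 + p.2.2.2.2)) ∘L fderiv ℂ ψ p.1

/-- The force contains two derivatives of `ψ` and one of `G`; three and two derivatives therefore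
make it `C¹`, hence locally Lipschitz. -/
theorem contDiffAt_tangentialForce {ψ : F' → F} {G : F → F →L[ℂ] F →L[ℂ] ℂ} {K : Submodule ℂ F}
    {p : F' × F' × F' × K × K} (hψ : ContDiffAt ℂ 3 ψ p.1)
    (hG : ContDiffAt ℂ 2 G (ψ p.1 + p.2.2.2.1)) :
    ContDiffAt ℂ 1 (tangentialForce ψ G K) p := by
  have hp : ContDiffAt ℂ 1 (fun q : F' × F' × F' × K × K => q.1) p := contDiffAt_fst
  have h1 : ContDiffAt ℂ 1 (fun q : F' × F' × F' × K × K => q.2.1) p := by fun_prop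
  have h2 : ContDiffAt ℂ 1 (fun q : F' × F' × F' × K × K => q.2.2.1) p := by fun_prop
  have h3 : ContDiffAt ℂ 1 (fun q : F' × F' × F' × K × K => (q.2.2.2.1 : F)) p :=
    K.subtypeL.contDiff.contDiffAt.comp p (by fun_prop)
  have h4 : ContDiffAt ℂ 1 (fun q : F' × F' × F' × K × K => (q.2.2.2.2 : F)) p :=
    K.subtypeL.contDiff.contDiffAt.comp p (by fun_prop)
  have d0 : ContDiffAt ℂ 1 (fun q : F' × F' × F' × K × K => ψ q.1 + (q.2.2.2.1 : F)) p :=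
    ((hψ.of_le (by norm_num)).comp p hp).add h3
  have d1 : ContDiffAt ℂ 2 (fderiv ℂ ψ) p.1 := hψ.fderiv_right (by norm_num)
  have d1' : ContDiffAt ℂ 1 (fun q : F' × F' × F' × K × K => fderiv ℂ ψ q.1) p :=
    (d1.of_le (by norm_num)).comp p hp
  have d2' : ContDiffAt ℂ 1
      (fun q : F' × F' × F' × K × K => fderiv ℂ (fderiv ℂ ψ) q.1) p :=
    (d1.fderiv_right (m := 1) (by norm_num)).comp p hp
  have dG : ContDiffAt ℂ 1
      (fun q : F' × F' × F' × K × K => G (ψ q.1 + (q.2.2.2.1 : F))) p :=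
    (hG.of_le (by norm_num)).comp p d0
  have dv := (d1'.clm_apply h1).add h4
  exact ((dG.clm_apply (((d2'.clm_apply h1).clm_apply h1).add (d1'.clm_apply h2))).add
    (contDiffAt_christoffelForm hG d0 dv dv)).clm_comp d1'

/-- A curve with vanishing acceleration that is tangent at one point to an immersion with maximal
isotropic image stays in the image of the immersion. -/
theorem exists_lift_of_acceleration_eq_zero [FiniteDimensional ℂ F] [FiniteDimensional ℂ F']
    (hdim : Module.finrank ℂ F = 2 * Module.finrank ℂ F')
    {ψ : F' → F} {G : F → F →L[ℂ] F →L[ℂ] ℂ} {y u : F'} {x : ℂ → F}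
    (hψ : ContDiffAt ℂ 3 ψ y) (hinj : Function.Injective (fderiv ℂ ψ y))
    (hG : ContDiffAt ℂ 2 G (ψ y)) (hsymm : ∀ p v w, G p v w = G p w v)
    (hnondeg : ∀ v, (∀ w, G (ψ y) v w = 0) → v = 0)
    (hiso : ∀ᶠ z in 𝓝 y, ∀ v w, G (ψ z) (fderiv ℂ ψ z v) (fderiv ℂ ψ z w) = 0)
    (hx : ContDiffAt ℂ 2 x 0) (hx0 : x 0 = ψ y) (hx1 : deriv x 0 = fderiv ℂ ψ y u)
    (hgeo : ∀ᶠ t in 𝓝 0, ∀ w, G (x t) (deriv (deriv x) t) w +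
      christoffel G (x t) (deriv x t) (deriv x t) w = 0) :
    ∃ c : ℂ → F', ContDiffAt ℂ 2 c 0 ∧ c 0 = y ∧ ∀ᶠ t in 𝓝 0, ψ (c t) = x t := by
  obtain ⟨K, hK⟩ := Submodule.exists_isCompl (fderiv ℂ ψ y).range
  obtain ⟨s, hs, hs0, hsΦ⟩ := exists_straightening (by norm_num) hψ hinj hK
  have hsx : ContDiffAt ℂ 2 (fun t => s (x t)) 0 :=
    ContDiffAt.comp (g := s) 0 (hx0 ▸ hs.of_le (by norm_num)) hx
  set c : ℂ → F' := fun t => (s (x t)).1 with hcdef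
  set k : ℂ → K := fun t => (s (x t)).2 with hkdef
  have hc : ContDiffAt ℂ 2 c 0 := contDiffAt_fst.comp (0 : ℂ) hsx
  have hk : ContDiffAt ℂ 2 k 0 := contDiffAt_snd.comp (0 : ℂ) hsx
  have hc0 : c 0 = y := by simp [hcdef, hx0, hs0]
  have hk0 : k 0 = 0 := by simp [hkdef, hx0, hs0]
  have hcc : Filter.Tendsto c (𝓝 0) (𝓝 y) := hc0 ▸ hc.continuousAt.tendsto
  have hxx : Filter.Tendsto x (𝓝 0) (𝓝 (ψ y)) := hx0 ▸ hx.continuousAt.tendsto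
  have hdec : ∀ᶠ t in 𝓝 0, ψ (c t) + k t = x t := hxx.eventually hsΦ
  have hψev : ∀ᶠ t in 𝓝 0, ContDiffAt ℂ 3 ψ (c t) :=
    hcc.eventually (hψ.eventually (by norm_num))
  have hcev := hc.eventually (by norm_num)
  have hkev := hk.eventually (by norm_num)
  have hd1 : ∀ᶠ t in 𝓝 0, deriv x t = fderiv ℂ ψ (c t) (deriv c t) + ((deriv k t : K) : F) := by
    filter_upwards [hdec.eventually_nhds, hψev, hcev, hkev] with t h1 h2 h3 h4
    have e1 : HasDerivAt (fun t => ψ (c t)) (fderiv ℂ ψ (c t) (deriv c t)) t :=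
      (h2.differentiableAt (by norm_num)).hasFDerivAt.comp_hasDerivAt t
        (h3.differentiableAt (by norm_num)).hasDerivAt
    have e2 : HasDerivAt (fun t => (k t : F)) ((deriv k t : K) : F) t :=
      K.subtypeL.hasFDerivAt.comp_hasDerivAt t (h4.differentiableAt (by norm_num)).hasDerivAt
    exact ((e1.add e2).congr_of_eventuallyEq (Filter.EventuallyEq.symm h1)).deriv
  have hd2 : ∀ᶠ t in 𝓝 0, deriv (deriv x) t =
      fderiv ℂ (fderiv ℂ ψ) (c t) (deriv c t) (deriv c t) +
        fderiv ℂ ψ (c t) (deriv (deriv c) t) + ((deriv (deriv k) t : K) : F) := by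
    filter_upwards [hd1.eventually_nhds, hψev, hcev, hkev] with t h1 h2 h3 h4
    have e1 := hasDerivAt_deriv_comp (h2.of_le (by norm_num)) h3
    have e2 : HasDerivAt (fun t => ((deriv k t : K) : F)) ((deriv (deriv k) t : K) : F) t :=
      K.subtypeL.hasFDerivAt.comp_hasDerivAt t
        ((contDiffAt_deriv h4).differentiableAt (by norm_num)).hasDerivAt
    exact ((e1.add e2).congr_of_eventuallyEq h1).deriv
  -- Tangency at `0` puts `k' 0` in the range of `dψ`, which meets `K` trivially.
  have hk1 : deriv k 0 = 0 := by
    have h := hd1.self_of_nhds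
    rw [hx1, hc0] at h
    have hmem : ((deriv k 0 : K) : F) ∈ (fderiv ℂ ψ y).range :=
      ⟨u - deriv c 0, by simp [h]⟩
    exact Subtype.ext (Submodule.disjoint_def.1 hK.disjoint _ hmem (deriv k 0).2)
  -- the pairing of the complement with the tangent space
  let T : F' × F → K →L[ℂ] (F' →L[ℂ] ℂ) := fun q =>
    ((ContinuousLinearMap.compL ℂ F' F ℂ).flip (fderiv ℂ ψ q.1)) ∘L (G q.2 ∘L K.subtypeL)
  have hT : ContinuousAt T (y, ψ y) := by
    have a1 : ContinuousAt (fun q : F' × F => fderiv ℂ ψ q.1) (y, ψ y) :=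
      ContinuousAt.comp (g := fderiv ℂ ψ)
        (hψ.fderiv_right (m := 1) (by norm_num)).continuousAt continuousAt_fst
    have a2 : ContinuousAt (fun q : F' × F => G q.2) (y, ψ y) :=
      ContinuousAt.comp (g := G) hG.continuousAt continuousAt_snd
    exact ((ContinuousLinearMap.compL ℂ F' F ℂ).flip.continuous.continuousAt.comp a1).clm_comp
      (a2.clm_comp continuousAt_const)
  -- A vector of `K` killed by `T` is orthogonal to the range of `dψ`. That range is isotropic of
  -- half dimension, so it is its own orthogonal and the vector lies in its intersection with `K`.
  have hTinj : Function.Injective (T (y, ψ y)) := by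
    rw [injective_iff_map_eq_zero]
    intro κ hκ
    let B : LinearMap.BilinForm ℂ F := LinearMap.mk₂ ℂ (fun v w => G (ψ y) v w)
      (by simp) (by simp) (by simp) (by simp)
    have hB : B.Nondegenerate :=
      ⟨hnondeg, fun w hw => hnondeg w fun v => (hsymm _ _ _).trans (hw v)⟩
    have hR : B.orthogonal (fderiv ℂ ψ y).range = (fderiv ℂ ψ y).range := by
      refine orthogonal_eq_of_finrank_add hB ?_ ?_
      · rintro _ ⟨v, rfl⟩ _ ⟨w, rfl⟩
        exact hiso.self_of_nhds w v
      · have := LinearMap.finrank_range_of_inj hinj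
        rw [hdim]
        change Module.finrank ℂ (fderiv ℂ ψ y).range = _ at this
        omega
    have hmem : (κ : F) ∈ B.orthogonal (fderiv ℂ ψ y).range := by
      rintro _ ⟨w, rfl⟩
      exact (hsymm _ _ _).trans (congrArg (fun L => L w) hκ)
    rw [hR] at hmem
    exact Subtype.ext (Submodule.disjoint_def.1 hK.disjoint _ hmem κ.2)
  obtain ⟨C, hC0, hC⟩ := eventually_norm_le_of_injective hT hTinj
  have hCt := (hcc.prodMk_nhds hxx).eventually hC
  -- the Lipschitz estimate for the tangential force
  let P : ℂ → F' × F' × F' × K × K :=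
    fun t => (c t, deriv c t, deriv (deriv c) t, k t, deriv k t)
  -- `P₀` is `P` with the transverse data set to zero, so the distance between the two is `‖(k,
  -- k')‖`.
  let P₀ : ℂ → F' × F' × F' × K × K := fun t => (c t, deriv c t, deriv (deriv c) t, 0, 0)
  have hc2 : ContinuousAt (deriv (deriv c)) 0 :=
    (((contDiffAt_deriv hc).fderiv_right (m := 0) (by norm_num)).clm_apply
      contDiffAt_const).continuousAt
  have hc1 : ContinuousAt (deriv c) 0 := (contDiffAt_deriv hc).continuousAt
  have hP : ContinuousAt P 0 := hc.continuousAt.prodMk <| hc1.prodMk <| hc2.prodMk <|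
    hk.continuousAt.prodMk (contDiffAt_deriv hk).continuousAt
  have hP₀ : ContinuousAt P₀ 0 := hc.continuousAt.prodMk <| hc1.prodMk <| hc2.prodMk <|
    continuousAt_const.prodMk continuousAt_const
  have hPP : P 0 = P₀ 0 := by simp [P, P₀, hk0, hk1]
  have hforce : ContDiffAt ℂ 1 (tangentialForce ψ G K) (P₀ 0) :=
    contDiffAt_tangentialForce (by simpa [P₀, hc0] using hψ) (by simpa [P₀, hc0] using hG)
  obtain ⟨L, S, hS, hL⟩ := hforce.exists_lipschitzOnWith
  -- On the surface the force vanishes whatever the curve `c`: the `c''` term by isotropy, the rest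
  -- because the second fundamental form is zero.
  have hforce0 : ∀ᶠ t in 𝓝 0, tangentialForce ψ G K (P₀ t) = 0 := by
    have hGev : ∀ᶠ z in 𝓝 y, ContDiffAt ℂ 2 G (ψ z) :=
      hψ.continuousAt.eventually (hG.eventually (by norm_num))
    filter_upwards [hψev, hcc.eventually hiso.eventually_nhds, hcc.eventually hGev]
      with t h1 h2 h3
    ext v
    have h4 := secondFundamentalForm_eq_zero (h1.of_le (by norm_num))
      (h3.differentiableAt (by norm_num)) hsymm h2 (deriv c t) (deriv c t) v
    have h5 := h2.self_of_nhds (deriv (deriv c) t) v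
    simp only [tangentialForce, P₀]
    simp [h5, h4]
  have hbound : ∀ᶠ t in 𝓝 0, ‖deriv (deriv k) t‖ ≤ C * L * ‖(k t, deriv k t)‖ := by
    filter_upwards [hgeo, hd1, hd2, hdec, hCt, hforce0, hP.eventually_mem (hPP ▸ hS),
      hP₀.eventually_mem hS] with t h1 h2 h3 h4 h5 h6 h7 h8
    -- The geodesic equation tested on the tangent vectors `dψ v`, solved for the term in `k''`.
    have e1 : T (c t, x t) (deriv (deriv k) t) = -tangentialForce ψ G K (P t) := by
      ext v
      have := h1 (fderiv ℂ ψ (c t) v)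
      rw [h3, h2, ← h4] at this
      simp only [T, tangentialForce, P, ← h4]
      simp only [map_add, add_apply, ContinuousLinearMap.coe_comp,
        Function.comp_apply, ContinuousLinearMap.flip_apply, ContinuousLinearMap.compL_apply,
        Submodule.subtypeL_apply, neg_apply, christoffelForm_apply] at this ⊢
      linear_combination this
    have e2 : ‖tangentialForce ψ G K (P t)‖ ≤ L * ‖(k t, deriv k t)‖ := by
      have h := hL.norm_sub_le h7 h8
      rw [h6, sub_zero] at h
      refine h.trans (le_of_eq ?_)
      simp [P, P₀, Prod.norm_def]
    have e3 := h5 (deriv (deriv k) t)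
    rw [e1, norm_neg] at e3
    rw [mul_assoc]
    exact e3.trans (by gcongr)
  have hzero := eventually_eq_zero_of_norm_deriv_deriv_le hk hk0 hk1 hbound
  refine ⟨c, hc, hc0, ?_⟩
  filter_upwards [hzero, hdec] with t h1 h2
  simpa [h1] using h2

end Lift

/-! ### Real vectors in complex isotropic subspaces -/

section Complexification

variable {V : Type*} [AddCommGroup V] [Module ℝ V]

/-- The real part of a complexified vector. -/
def rePart (V : Type*) [AddCommGroup V] [Module ℝ V] : ℂ ⊗[ℝ] V →ₗ[ℝ] V :=
  (TensorProduct.lid ℝ V).toLinearMap ∘ₗ LinearMap.rTensor V Complex.reLm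

/-- The imaginary part of a complexified vector. -/
def imPart (V : Type*) [AddCommGroup V] [Module ℝ V] : ℂ ⊗[ℝ] V →ₗ[ℝ] V :=
  (TensorProduct.lid ℝ V).toLinearMap ∘ₗ LinearMap.rTensor V Complex.imLm

@[simp]
theorem rePart_complexVector (a b : V) : rePart V (complexVector a b) = a := by
  simp [rePart, complexVector]

@[simp]
theorem imPart_complexVector (a b : V) : imPart V (complexVector a b) = b := by
  simp [imPart, complexVector]

theorem complexVector_rePart_imPart (z : ℂ ⊗[ℝ] V) :
    complexVector (rePart V z) (imPart V z) = z := by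
  induction z using TensorProduct.induction_on with
  | zero => simp [complexVector]
  | tmul c v =>
    simp only [complexVector, rePart, imPart, LinearMap.coe_comp, Function.comp_apply,
      LinearMap.rTensor_tmul, LinearEquiv.coe_coe, TensorProduct.lid_tmul, Complex.reLm_coe,
      Complex.imLm_coe, TensorProduct.tmul_smul, ← TensorProduct.add_tmul,
      TensorProduct.smul_tmul']
    congr 1
    simp
  | add x y hx hy =>
    conv_rhs => rw [← hx, ← hy]
    simp only [complexVector, map_add, TensorProduct.tmul_add]
    abel

theorem I_smul_complexVector (a b : V) :
    Complex.I • complexVector a b = complexVector (-b) a := by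
  simp [complexVector, TensorProduct.smul_tmul', TensorProduct.neg_tmul, TensorProduct.tmul_neg,
    add_comm]

theorem conjugation_complexVector (a b : V) :
    conjugation V (complexVector a b) = complexVector a (-b) := by
  simp [conjugation, complexVector, TensorProduct.neg_tmul, TensorProduct.tmul_neg]

theorem one_tmul_eq_complexVector (a : V) : (1 : ℂ) ⊗ₜ[ℝ] a = complexVector a 0 := by
  simp [complexVector]

theorem baseChange_complexVector (β : LinearMap.BilinForm ℝ V) (a b c d : V) :
    β.baseChange ℂ (complexVector a b) (complexVector c d) =
      ⟨β a c - β b d, β a d + β b c⟩ := by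
  simp only [complexVector, map_add, LinearMap.add_apply, LinearMap.BilinForm.baseChange_tmul]
  simp only [Complex.ext_iff]
  constructor <;> simp <;> ring

theorem isIsotropic_complexVector {β : LinearMap.BilinForm ℝ V} {D : Submodule ℂ (ℂ ⊗[ℝ] V)}
    (hD : IsIsotropic β D) {a b c d : V} (h₁ : complexVector a b ∈ D) (h₂ : complexVector c d ∈ D) :
    β a c = β b d ∧ β a d = -β b c := by
  have h := hD _ h₁ _ h₂
  rw [baseChange_complexVector, Complex.ext_iff] at h
  exact ⟨by simpa [sub_eq_zero] using h.1, by simpa [add_eq_zero_iff_eq_neg] using h.2⟩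

/-- The real vectors that lie in a complex subspace of the complexification. -/
def realPoints (D : Submodule ℂ (ℂ ⊗[ℝ] V)) : Submodule ℝ V :=
  (D.restrictScalars ℝ).comap (TensorProduct.mk ℝ ℂ V 1)

@[simp]
theorem mem_realPoints {D : Submodule ℂ (ℂ ⊗[ℝ] V)} {v : V} :
    v ∈ realPoints D ↔ (1 : ℂ) ⊗ₜ[ℝ] v ∈ D := Iff.rfl

theorem complexVector_zero_mem_iff {D : Submodule ℂ (ℂ ⊗[ℝ] V)} {v : V} :
    complexVector 0 v ∈ D ↔ (1 : ℂ) ⊗ₜ[ℝ] v ∈ D := by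
  have h : complexVector 0 v = Complex.I • ((1 : ℂ) ⊗ₜ[ℝ] v) := by
    rw [one_tmul_eq_complexVector, I_smul_complexVector, neg_zero]
  rw [h]
  exact Submodule.smul_mem_iff D Complex.I_ne_zero

/-- Rank-nullity for the real part on `D`: its kernel consists of the purely imaginary vectors of
`D`, and multiplication by `i` identifies it with the real points. -/
theorem finrank_map_rePart_add_finrank_realPoints [FiniteDimensional ℝ V]
    (D : Submodule ℂ (ℂ ⊗[ℝ] V)) :
    Module.finrank ℝ ((D.restrictScalars ℝ).map (rePart V)) + Module.finrank ℝ (realPoints D) =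
      2 * Module.finrank ℂ D := by
  let f : D.restrictScalars ℝ →ₗ[ℝ] V := (rePart V).domRestrict (D.restrictScalars ℝ)
  have hV : FiniteDimensional ℝ (ℂ ⊗[ℝ] V) := inferInstance
  have h1 : Module.finrank ℝ f.range + Module.finrank ℝ f.ker =
    Module.finrank ℝ (D.restrictScalars ℝ) := f.finrank_range_add_finrank_ker
  have h2 : f.range = (D.restrictScalars ℝ).map (rePart V) := LinearMap.range_domRestrict _ _
  have h3 : Module.finrank ℝ (D.restrictScalars ℝ) = 2 * Module.finrank ℂ D :=
    finrank_real_of_complex D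
  let e : f.ker ≃ₗ[ℝ] realPoints D :=
    LinearEquiv.ofBijective
      (((imPart V) ∘ₗ (D.restrictScalars ℝ).subtype ∘ₗ f.ker.subtype).codRestrict _ (by
        rintro ⟨⟨z, hz⟩, hz0⟩
        have hre : rePart V z = 0 := hz0
        have hz' : z ∈ D := hz
        rw [← complexVector_rePart_imPart z, hre] at hz'
        exact complexVector_zero_mem_iff.1 hz'))
      (by
        constructor
        · rw [injective_iff_map_eq_zero]
          rintro ⟨⟨z, hz⟩, hz0⟩ h
          have hre : rePart V z = 0 := hz0
          have him : imPart V z = 0 := congrArg Subtype.val h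
          have : z = 0 := by
            rw [← complexVector_rePart_imPart z, hre, him]
            simp [complexVector]
          simpa using this
        · rintro ⟨v, hv⟩
          exact ⟨⟨⟨complexVector 0 v, complexVector_zero_mem_iff.2 hv⟩,
            by simp [f]⟩, Subtype.ext (imPart_complexVector 0 v)⟩)
  rw [← h2, ← h3, ← h1, e.finrank_eq]

/-- A maximal isotropic subspace contains every real vector orthogonal to it. -/
theorem orthogonal_map_rePart [FiniteDimensional ℝ V] {β : LinearMap.BilinForm ℝ V}
    (hsymm : ∀ u v, β u v = β v u) (hnondeg : β.Nondegenerate) {D : Submodule ℂ (ℂ ⊗[ℝ] V)}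
    (hD : IsIsotropic β D) (hdim : Module.finrank ℝ V = 2 * Module.finrank ℂ D) :
    β.orthogonal ((D.restrictScalars ℝ).map (rePart V)) = realPoints D := by
  -- The dimensions are complementary, so only orthogonality of real points to real parts is left,
  -- and that is isotropy.
  refine orthogonal_eq_of_finrank_add hnondeg ?_
    ((finrank_map_rePart_add_finrank_realPoints D).trans hdim.symm)
  rintro v hv _ ⟨z, hz, rfl⟩
  rw [mem_realPoints, one_tmul_eq_complexVector] at hv
  have hz' : complexVector (rePart V z) (imPart V z) ∈ D := by
    rw [complexVector_rePart_imPart]; exact hz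
  have := (isIsotropic_complexVector hD hv hz').1
  exact (hsymm _ _).trans (by simpa using this)

/-- Turns membership of a real vector in `D` into finitely many real linear equations; this yields
both the smooth null field and its geodesic property. -/
theorem one_tmul_mem_of_frame [FiniteDimensional ℝ V] {β : LinearMap.BilinForm ℝ V}
    (hsymm : ∀ u v, β u v = β v u) (hnondeg : β.Nondegenerate) {ι : Type*} {A B : ι → V}
    {D : Submodule ℂ (ℂ ⊗[ℝ] V)} 
    (hspan : D = Submodule.span ℂ (Set.range fun i => complexVector (A i) (B i)))
    (hD : IsIsotropic β D) (hdim : Module.finrank ℝ V = 2 * Module.finrank ℂ D) {v : V}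
    (hA : ∀ i, β v (A i) = 0) (hB : ∀ i, β v (B i) = 0) : (1 : ℂ) ⊗ₜ[ℝ] v ∈ D := by
  rw [← mem_realPoints, ← orthogonal_map_rePart hsymm hnondeg hD hdim]
  rintro _ ⟨z, hz, rfl⟩
  -- Imaginary parts are included because complex scalars mix the two parts in the span induction.
  suffices h : β v (rePart V z) = 0 ∧ β v (imPart V z) = 0 from (hsymm _ _).trans h.1
  have hz' : z ∈ Submodule.span ℂ (Set.range fun i => complexVector (A i) (B i)) := by
    rw [← hspan]; exact hz
  induction hz' using Submodule.span_induction with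
  | mem x hx =>
    obtain ⟨i, rfl⟩ := hx
    simp [hA, hB]
  | zero => simp
  | add x y hx hy h1 h2 =>
    have h1 := h1 (by rw [hspan]; exact hx)
    have h2 := h2 (by rw [hspan]; exact hy)
    simp [h1, h2]
  | smul c x hx h =>
    have h := h (by rw [hspan]; exact hx)
    have hc : c • x = c.re • x + c.im • complexVector (-imPart V x) (rePart V x) := by
      rw [← I_smul_complexVector, complexVector_rePart_imPart]
      conv_lhs => rw [← Complex.re_add_im c, add_smul, mul_smul]
      rfl
    simp [hc, h]

theorem orthogonal_of_mem_of_frame {β : LinearMap.BilinForm ℝ V} {D : Submodule ℂ (ℂ ⊗[ℝ] V)}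
    (hD : IsIsotropic β D) {v a b : V} (hv : (1 : ℂ) ⊗ₜ[ℝ] v ∈ D) (hab : complexVector a b ∈ D) :
    β v a = 0 ∧ β v b = 0 := by
  rw [one_tmul_eq_complexVector] at hv
  have := isIsotropic_complexVector hD hv hab
  simpa using this

end Complexification

/-! ### Maximal isotropic subspaces in Lorentzian signature -/

section Lorentzian

variable {V : Type*} [AddCommGroup V] [Module ℝ V]

theorem linearIndependent_pair_of_orthogonal {β : LinearMap.BilinForm ℝ V}
    (hsymm : ∀ u v, β u v = β v u) {t c : V} (htc : β t c = 0) (ht : β t t ≠ 0) (hc : β c c ≠ 0) :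
    LinearIndependent ℝ ![t, c] := by
  rw [LinearIndependent.pair_iff]
  intro x y h
  have h1 := congrArg (β t) h
  have h2 := congrArg (β c) h
  simp [htc, hsymm c t, ht, hc] at h1 h2
  exact ⟨h1, h2⟩

theorem finrank_span_pair {t c : V}
    (h : LinearIndependent ℝ ![t, c]) :
    Module.finrank ℝ (Submodule.span ℝ {t, c}) = 2 := by
  have hr : Set.range ![t, c] = {t, c} := by
    ext v
    simp [or_comm]
  have := finrank_span_eq_card h
  rwa [hr] at this

variable [FiniteDimensional ℝ V]

/-- If the first claim failed at a positive `t`, then `t` and `c` would span a positive definite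
plane. The second is witnessed by a maximal negative definite subspace. Both conclusions are
unchanged under `β ↦ -β`, which settles the other sign convention. -/
theorem exists_of_sigPos_eq_one {β : LinearMap.BilinForm ℝ V} (hsymm : ∀ u v, β u v = β v u)
    (hpos : sigPos (LinearMap.BilinMap.toQuadraticMap β : QuadraticForm ℝ V) = 1)
    (hneg : sigNeg (LinearMap.BilinMap.toQuadraticMap β : QuadraticForm ℝ V) + 1 =
      Module.finrank ℝ V) :
    (∃ t, ∀ c, β t c = 0 → β c c ≠ β t t) ∧
      ∃ W : Submodule ℝ V, Module.finrank ℝ W + 1 = Module.finrank ℝ V ∧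
        ∀ w ∈ W, β w w = 0 → w = 0 := by
  constructor
  · obtain ⟨U, hU, hUpos⟩ := exists_finrank_eq_sigPos_and_posDef
      (LinearMap.BilinMap.toQuadraticMap β : QuadraticForm ℝ V)
    rw [hpos] at hU
    have : Nontrivial U := Module.nontrivial_of_finrank_pos (R := ℝ) (by omega)
    obtain ⟨t, ht⟩ := exists_ne (0 : U)
    have htt : 0 < β t t := hUpos t ht
    refine ⟨t, fun c hc hcc => ?_⟩
    have hind := linearIndependent_pair_of_orthogonal hsymm hc htt.ne' (hcc ▸ htt.ne')
    have hle := le_sigPos_of_posDef (LinearMap.BilinMap.toQuadraticMap β : QuadraticForm ℝ V)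
      (V := Submodule.span ℝ {(t : V), c}) ?_
    · rw [hpos, finrank_span_pair hind] at hle
      omega
    · rintro ⟨v, hv⟩ hv0
      obtain ⟨x, y, rfl⟩ := Submodule.mem_span_pair.1 hv
      have hxy : x ≠ 0 ∨ y ≠ 0 := by
        by_contra! h
        exact hv0 (by simp [h.1, h.2])
      have hval : β (x • (t : V) + y • c) (x • (t : V) + y • c) = (x ^ 2 + y ^ 2) * β t t := by
        simp [hc, hsymm c t, hcc]
        ring
      have : 0 < β (x • (t : V) + y • c) (x • (t : V) + y • c) := by
        rw [hval]
        refine mul_pos ?_ htt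
        rcases hxy with h | h <;> positivity
      exact this
  · obtain ⟨W, hW, hWneg⟩ := exists_finrank_eq_sigNeg_and_negDef
      (LinearMap.BilinMap.toQuadraticMap β : QuadraticForm ℝ V)
    refine ⟨W, by rw [hW, hneg], fun w hw h0 => ?_⟩
    by_contra hne
    have h : 0 < -β w w := hWneg ⟨w, hw⟩ (by simpa using hne)
    rw [h0] at h
    simp at h

theorem exists_of_isLorentzian {β : LinearMap.BilinForm ℝ V} (hsymm : ∀ u v, β u v = β v u)
    (hL : IsLorentzian β) :
    (∃ t, ∀ c, β t c = 0 → β c c ≠ β t t) ∧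
      ∃ W : Submodule ℝ V, Module.finrank ℝ W + 1 = Module.finrank ℝ V ∧
        ∀ w ∈ W, β w w = 0 → w = 0 := by
  rcases hL with ⟨h1, h2⟩ | ⟨h1, h2⟩
  · exact exists_of_sigPos_eq_one hsymm h1 h2
  · have hQ : (LinearMap.BilinMap.toQuadraticMap (-β) : QuadraticForm ℝ V) =
        -LinearMap.BilinMap.toQuadraticMap β := by ext; simp
    simpa using exists_of_sigPos_eq_one (β := -β) (by simpa using hsymm)
      (by rw [hQ, sigPos_neg, h1]) (by rw [hQ, sigNeg_neg, h2])

/-- A maximal isotropic subspace for a Lorentzian form contains a nonzero real vector. -/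
theorem exists_one_tmul_mem {β : LinearMap.BilinForm ℝ V} (hsymm : ∀ u v, β u v = β v u)
    (hL : IsLorentzian β) {D : Submodule ℂ (ℂ ⊗[ℝ] V)} (hD : IsIsotropic β D)
    (hdim : Module.finrank ℝ V = 2 * Module.finrank ℂ D) : ∃ k ≠ 0, (1 : ℂ) ⊗ₜ[ℝ] k ∈ D := by
  by_contra! h
  obtain ⟨⟨t, ht⟩, -⟩ := exists_of_isLorentzian hsymm hL
  have hbot : realPoints D = ⊥ := by
    rw [Submodule.eq_bot_iff]
    intro v hv
    by_contra hv0
    exact h v hv0 hv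
  have hsum := finrank_map_rePart_add_finrank_realPoints D
  rw [hbot, finrank_bot, add_zero, ← hdim] at hsum
  -- Every real vector is now a real part. For `t + ic` in `D`, isotropy gives `β t c = 0` and `β t
  -- t = β c c`, which the choice of `t` excludes.
  have htop := Submodule.eq_top_of_finrank_eq hsum
  obtain ⟨z, hz, hzt⟩ : t ∈ (D.restrictScalars ℝ).map (rePart V) := htop ▸ Submodule.mem_top
  have hz' : complexVector (rePart V z) (imPart V z) ∈ D := by
    rw [complexVector_rePart_imPart]; exact hz
  rw [hzt] at hz'
  obtain ⟨h1, h2⟩ := isIsotropic_complexVector hD hz' hz'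
  rw [hsymm (imPart V z) t] at h2
  exact ht _ (by linarith) h1.symm

/-- For a Lorentzian form the real vectors in an isotropic subspace are proportional. -/
theorem exists_smul_eq_of_one_tmul_mem {β : LinearMap.BilinForm ℝ V}
    (hsymm : ∀ u v, β u v = β v u) (hL : IsLorentzian β) {D : Submodule ℂ (ℂ ⊗[ℝ] V)}
    (hD : IsIsotropic β D) {k v : V} (hk0 : k ≠ 0) (hk : (1 : ℂ) ⊗ₜ[ℝ] k ∈ D)
    (hv : (1 : ℂ) ⊗ₜ[ℝ] v ∈ D) : ∃ x : ℝ, x • k = v := by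
  obtain ⟨-, W, hW, hWani⟩ := exists_of_isLorentzian hsymm hL
  by_contra hne
  have hind : LinearIndependent ℝ ![k, v] :=
    (LinearIndependent.pair_iff' hk0).2 fun x hx => hne ⟨x, hx⟩
  -- The plane of real vectors of `D` would be totally null, hence disjoint from the anisotropic
  -- hyperplane `W`, which is one dimension too many.
  have hdisj : Disjoint (Submodule.span ℝ {k, v}) W := by
    rw [Submodule.disjoint_def]
    intro w hw hwW
    refine hWani w hwW ?_
    have hwD : (1 : ℂ) ⊗ₜ[ℝ] w ∈ D := by
      have hle : Submodule.span ℝ {k, v} ≤ realPoints D := by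
        rw [Submodule.span_le]
        rintro u (rfl | rfl)
        exacts [hk, hv]
      exact hle hw
    rw [one_tmul_eq_complexVector] at hwD
    simpa using (isIsotropic_complexVector hD hwD hwD).1
  have := Submodule.finrank_add_finrank_le_of_disjoint hdisj
  rw [finrank_span_pair hind] at this
  omega

/-- The intersection is stable under conjugation, so it contains the real and imaginary parts of its
elements; these are real vectors of `D`, hence multiples of `k`. -/
theorem inf_conjugate_eq_span {β : LinearMap.BilinForm ℝ V} (hsymm : ∀ u v, β u v = β v u)
    (hL : IsLorentzian β) {D : Submodule ℂ (ℂ ⊗[ℝ] V)} (hD : IsIsotropic β D) {k : V} (hk0 : k ≠ 0)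
    (hk : (1 : ℂ) ⊗ₜ[ℝ] k ∈ D) : D ⊓ conjugate D = Submodule.span ℂ {(1 : ℂ) ⊗ₜ[ℝ] k} := by
  refine le_antisymm ?_ ?_
  · rintro z ⟨hz, hzc⟩
    have hzc' : conjugation V z ∈ D := hzc
    rw [← complexVector_rePart_imPart z] at hz hzc' ⊢
    rw [conjugation_complexVector] at hzc'
    set a := rePart V z
    set b := imPart V z
    have ha : (1 : ℂ) ⊗ₜ[ℝ] a ∈ D := by
      have h := D.smul_mem (2⁻¹ : ℂ) (D.add_mem hz hzc')
      convert h using 1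
      simp only [complexVector, TensorProduct.tmul_neg]
      rw [add_add_add_comm, add_neg_cancel, add_zero, ← two_smul ℂ, smul_smul]
      norm_num
    have hb : (1 : ℂ) ⊗ₜ[ℝ] b ∈ D := by
      rw [← complexVector_zero_mem_iff]
      have h := D.sub_mem hz ha
      convert h using 1
      simp [complexVector]
    obtain ⟨x, hx⟩ := exists_smul_eq_of_one_tmul_mem hsymm hL hD hk0 hk ha
    obtain ⟨y, hy⟩ := exists_smul_eq_of_one_tmul_mem hsymm hL hD hk0 hk hb
    rw [Submodule.mem_span_singleton]
    refine ⟨x + y * Complex.I, ?_⟩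
    rw [← hx, ← hy, complexVector, TensorProduct.tmul_smul, TensorProduct.tmul_smul, add_smul,
      mul_smul]
    simp [TensorProduct.smul_tmul']
  · rw [Submodule.span_singleton_le_iff_mem]
    refine ⟨hk, ?_⟩
    change conjugation V _ ∈ D
    rw [one_tmul_eq_complexVector, conjugation_complexVector, neg_zero, ← one_tmul_eq_complexVector]
    exact hk

end Lorentzian

/-! ### Metrics, vector fields and brackets in charts -/

section Chart

variable {𝕜 : Type*} [RCLike 𝕜] {E : Type*} [NormedAddCommGroup E] [NormedSpace 𝕜 E]
  {M : Type*} [TopologicalSpace M] [ChartedSpace E M]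

/-- The differential of the inverse of the preferred chart at `p`. -/
def chartDeriv (𝕜 : Type*) [RCLike 𝕜] {E : Type*} [NormedAddCommGroup E] [NormedSpace 𝕜 E]
    {M : Type*} [TopologicalSpace M] [ChartedSpace E M] (p : M) (y : E) :
    E →L[𝕜] TangentSpace 𝓘(𝕜, E) ((extChartAt 𝓘(𝕜, E) p).symm y) :=
  mfderiv 𝓘(𝕜, E) 𝓘(𝕜, E) (extChartAt 𝓘(𝕜, E) p).symm y

/-- The expression of a vector field in the preferred chart at `p`. -/
def chartField (p : M) (V : ∀ x : M, TangentSpace 𝓘(𝕜, E) x) (y : E) : E :=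
  mfderiv 𝓘(𝕜, E) 𝓘(𝕜, E) (extChartAt 𝓘(𝕜, E) p) ((extChartAt 𝓘(𝕜, E) p).symm y)
    (V ((extChartAt 𝓘(𝕜, E) p).symm y))

theorem inChart_apply (g : ∀ x : M, TangentSpace 𝓘(𝕜, E) x →L[𝕜] TangentSpace 𝓘(𝕜, E) x →L[𝕜] 𝕜)
    (p : M) (y u v : E) :
    inChart g p y u v = g ((extChartAt 𝓘(𝕜, E) p).symm y) (chartDeriv 𝕜 p y u)
      (chartDeriv 𝕜 p y v) := rfl

theorem inChart_symm {n : WithTop ℕ∞}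
    {g : ∀ x : M, TangentSpace 𝓘(𝕜, E) x →L[𝕜] TangentSpace 𝓘(𝕜, E) x →L[𝕜] 𝕜}
    (hg : IsMetric n g) (p : M) (y u v : E) : inChart g p y u v = inChart g p y v u := by
  rw [inChart_apply, inChart_apply, hg.symm]

theorem isOpen_chart_preimage (p : M) {U : Set M} (hU : IsOpen U) :
    IsOpen ((extChartAt 𝓘(𝕜, E) p).target ∩ (extChartAt 𝓘(𝕜, E) p).symm ⁻¹' U) :=
  (continuousOn_extChartAt_symm p).isOpen_inter_preimage (isOpen_extChartAt_target p) hU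

variable [IsManifold 𝓘(𝕜, E) 1 M]

/-- The vector field with a given expression in the preferred chart at `p`. -/
def ofChartField (p : M) (v : E → E) (x : M) : TangentSpace 𝓘(𝕜, E) x :=
  (trivializationAt E (TangentSpace 𝓘(𝕜, E)) p).symmL 𝕜 x (v (extChartAt 𝓘(𝕜, E) p x))

theorem chartDeriv_chartField (p : M) (V : ∀ x : M, TangentSpace 𝓘(𝕜, E) x) {y : E}
    (hy : y ∈ (extChartAt 𝓘(𝕜, E) p).target) :
    chartDeriv 𝕜 p y (chartField p V y) = V ((extChartAt 𝓘(𝕜, E) p).symm y) := by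
  have h := mfderivWithin_extChartAt_symm_comp_mfderiv_extChartAt (I := 𝓘(𝕜, E)) hy
  rw [modelWithCornersSelf_coe, Set.range_id, mfderivWithin_univ] at h
  exact congrArg (fun L => L (V ((extChartAt 𝓘(𝕜, E) p).symm y))) h

theorem mfderiv_extChartAt_chartDeriv (p : M) {y : E}
    (hy : y ∈ (extChartAt 𝓘(𝕜, E) p).target) (v : E) :
    mfderiv 𝓘(𝕜, E) 𝓘(𝕜, E) (extChartAt 𝓘(𝕜, E) p) ((extChartAt 𝓘(𝕜, E) p).symm y)
      (chartDeriv 𝕜 p y v) = v := by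
  have h := mfderiv_extChartAt_comp_mfderivWithin_extChartAt_symm (I := 𝓘(𝕜, E)) hy
  rw [modelWithCornersSelf_coe, Set.range_id, mfderivWithin_univ] at h
  exact congrArg (fun L => L v) h

theorem chartDeriv_injective (p : M) {y : E} (hy : y ∈ (extChartAt 𝓘(𝕜, E) p).target) :
    Function.Injective (chartDeriv 𝕜 p y) := fun u v h => by
  rw [← mfderiv_extChartAt_chartDeriv p hy u, h, mfderiv_extChartAt_chartDeriv p hy v]

theorem chartDeriv_surjective (p : M) {y : E} (hy : y ∈ (extChartAt 𝓘(𝕜, E) p).target) :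
    Function.Surjective (chartDeriv 𝕜 p y) := fun v => by
  have h := mfderivWithin_extChartAt_symm_comp_mfderiv_extChartAt (I := 𝓘(𝕜, E)) hy
  rw [modelWithCornersSelf_coe, Set.range_id, mfderivWithin_univ] at h
  exact ⟨_, congrArg (fun L => L v) h⟩

theorem chartDeriv_isInvertible (p : M) {y : E} (hy : y ∈ (extChartAt 𝓘(𝕜, E) p).target) :
    (mfderiv 𝓘(𝕜, E) 𝓘(𝕜, E) (extChartAt 𝓘(𝕜, E) p).symm y).IsInvertible := by
  have h := isInvertible_mfderivWithin_extChartAt_symm (I := 𝓘(𝕜, E)) hy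
  rwa [modelWithCornersSelf_coe, Set.range_id, mfderivWithin_univ] at h

theorem ofChartField_symm (p : M) (v : E → E) {y : E}
    (hy : y ∈ (extChartAt 𝓘(𝕜, E) p).target) :
    ofChartField p v ((extChartAt 𝓘(𝕜, E) p).symm y) = chartDeriv 𝕜 p y (v y) := by
  have hx := (extChartAt 𝓘(𝕜, E) p).map_target hy
  rw [extChartAt_source] at hx
  have h := TangentBundle.symmL_trivializationAt (I := 𝓘(𝕜, E)) hx
  rw [modelWithCornersSelf_coe, Set.range_id, mfderivWithin_univ,
    (extChartAt 𝓘(𝕜, E) p).right_inv hy] at h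
  unfold ofChartField
  rw [(extChartAt 𝓘(𝕜, E) p).right_inv hy]
  exact congrArg (fun L => L (v y)) h

theorem nondegenerate_inChart {n : WithTop ℕ∞}
    {g : ∀ x : M, TangentSpace 𝓘(𝕜, E) x →L[𝕜] TangentSpace 𝓘(𝕜, E) x →L[𝕜] 𝕜}
    (hg : IsMetric n g) (p : M) {y : E} (hy : y ∈ (extChartAt 𝓘(𝕜, E) p).target) {u : E}
    (hu : ∀ v, inChart g p y u v = 0) : u = 0 := by
  apply chartDeriv_injective p hy
  rw [map_zero]
  refine hg.nondegenerate _ _ fun v => ?_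
  obtain ⟨w, rfl⟩ := chartDeriv_surjective p hy v
  exact hu w

/-- The trivialization of the tangent bundle at `p` is the differential of the chart. The tangent
bundle is one order less smooth than the manifold, hence `n + 1`. -/
theorem contDiffOn_chartField {n : WithTop ℕ∞} [IsManifold 𝓘(𝕜, E) (n + 1) M] (p : M)
    {V : ∀ x : M, TangentSpace 𝓘(𝕜, E) x} {U : Set M} (hU : IsOpen U)
    (hV : ContMDiffOn 𝓘(𝕜, E) 𝓘(𝕜, E).tangent n
      (fun x => (⟨x, V x⟩ : TangentBundle 𝓘(𝕜, E) M)) U) :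
    ContDiffOn 𝕜 n (chartField p V)
      ((extChartAt 𝓘(𝕜, E) p).target ∩ (extChartAt 𝓘(𝕜, E) p).symm ⁻¹' U) := by
  have : IsManifold 𝓘(𝕜, E) n M := IsManifold.of_le (n := n + 1) le_self_add
  have : ContMDiffVectorBundle n E (TangentSpace 𝓘(𝕜, E) : M → Type _) 𝓘(𝕜, E) :=
    TangentBundle.contMDiffVectorBundle
  set e := trivializationAt E (TangentSpace 𝓘(𝕜, E)) p with he
  have hbase : e.baseSet = (chartAt E p).source := TangentBundle.trivializationAt_baseSet p
  have h1 := (e.contMDiffOn_section_iff (IB := 𝓘(𝕜, E)) (n := n) (s := V) (hU.inter e.open_baseSet)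
    Set.inter_subset_right).1 (hV.mono Set.inter_subset_left)
  have h2 : ContMDiffOn 𝓘(𝕜, E) 𝓘(𝕜, E) n (extChartAt 𝓘(𝕜, E) p).symm
      ((extChartAt 𝓘(𝕜, E) p).target ∩ (extChartAt 𝓘(𝕜, E) p).symm ⁻¹' U) :=
    (contMDiffOn_extChartAt_symm p).mono Set.inter_subset_left
  have hmaps : ∀ y ∈ (extChartAt 𝓘(𝕜, E) p).target ∩ (extChartAt 𝓘(𝕜, E) p).symm ⁻¹' U,
      (extChartAt 𝓘(𝕜, E) p).symm y ∈ U ∩ e.baseSet := by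
    intro y hy
    refine ⟨hy.2, ?_⟩
    have := (extChartAt 𝓘(𝕜, E) p).map_target hy.1
    rwa [extChartAt_source, ← hbase] at this
  refine ((h1.comp h2 hmaps).congr fun y hy => ?_).contDiffOn
  have hx := (hmaps y hy).2
  rw [hbase] at hx
  have h3 := TangentBundle.continuousLinearMapAt_trivializationAt (I := 𝓘(𝕜, E)) hx
  have h4 := congrArg (fun L => L (V ((extChartAt 𝓘(𝕜, E) p).symm y))) h3
  refine Eq.trans h4.symm ?_
  exact e.continuousLinearMapAt_apply_of_mem 𝕜 (hmaps y hy).2 _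

theorem contMDiffOn_ofChartField {n : WithTop ℕ∞} [IsManifold 𝓘(𝕜, E) (n + 1) M] (p : M)
    {v : E → E} {S : Set E} (hS : IsOpen S) (hv : ContDiffOn 𝕜 n v S) :
    ContMDiffOn 𝓘(𝕜, E) 𝓘(𝕜, E).tangent n
      (fun x => (⟨x, ofChartField p v x⟩ : TangentBundle 𝓘(𝕜, E) M))
      ((extChartAt 𝓘(𝕜, E) p).source ∩ extChartAt 𝓘(𝕜, E) p ⁻¹' S) := by
  have : IsManifold 𝓘(𝕜, E) n M := IsManifold.of_le (n := n + 1) le_self_add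
  have : ContMDiffVectorBundle n E (TangentSpace 𝓘(𝕜, E) : M → Type _) 𝓘(𝕜, E) :=
    TangentBundle.contMDiffVectorBundle
  set e := trivializationAt E (TangentSpace 𝓘(𝕜, E)) p with he
  have hbase : e.baseSet = (chartAt E p).source := TangentBundle.trivializationAt_baseSet p
  have hopen : IsOpen ((extChartAt 𝓘(𝕜, E) p).source ∩ extChartAt 𝓘(𝕜, E) p ⁻¹' S) :=
    (continuousOn_extChartAt p).isOpen_inter_preimage (isOpen_extChartAt_source p) hS
  have hsub : (extChartAt 𝓘(𝕜, E) p).source ∩ extChartAt 𝓘(𝕜, E) p ⁻¹' S ⊆ e.baseSet := by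
    rw [hbase, ← extChartAt_source 𝓘(𝕜, E)]
    exact Set.inter_subset_left
  refine (e.contMDiffOn_section_iff (IB := 𝓘(𝕜, E)) (n := n) (s := ofChartField p v) hopen hsub).2 ?_
  have h1 : ContMDiffOn 𝓘(𝕜, E) 𝓘(𝕜, E) n (extChartAt 𝓘(𝕜, E) p)
      ((extChartAt 𝓘(𝕜, E) p).source ∩ extChartAt 𝓘(𝕜, E) p ⁻¹' S) := by
    refine (contMDiffOn_extChartAt (x := p)).mono ?_
    rw [← extChartAt_source 𝓘(𝕜, E)]
    exact Set.inter_subset_left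
  refine (hv.contMDiffOn.comp h1 fun x hx => hx.2).congr fun x hx => ?_
  have h2 := e.apply_mk_symm (hsub hx) (v (extChartAt 𝓘(𝕜, E) p x))
  rw [← e.symmL_apply (R := 𝕜) (hsub hx)] at h2
  exact congrArg Prod.snd h2

/-- The tangent spaces at `x` and at `φ.symm (φ x)` are fibres over points that are equal only
propositionally; a predicate on tangent vectors is carried across by substitution. -/
theorem mfderiv_comp_extChartAt_pred (p : M) {x : M} (hx : x ∈ (extChartAt 𝓘(𝕜, E) p).source)
    (P : ∀ x : M, TangentSpace 𝓘(𝕜, E) x → Prop) {v : TangentSpace 𝓘(𝕜, E) x} (hv : P x v) :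
    P ((extChartAt 𝓘(𝕜, E) p).symm (extChartAt 𝓘(𝕜, E) p x))
      (chartDeriv 𝕜 p (extChartAt 𝓘(𝕜, E) p x)
        (mfderiv 𝓘(𝕜, E) 𝓘(𝕜, E) (extChartAt 𝓘(𝕜, E) p) x v)) := by
  obtain ⟨y, hy, rfl⟩ : ∃ y ∈ (extChartAt 𝓘(𝕜, E) p).target, (extChartAt 𝓘(𝕜, E) p).symm y = x :=
    ⟨_, (extChartAt 𝓘(𝕜, E) p).map_source hx, (extChartAt 𝓘(𝕜, E) p).left_inv hx⟩
  obtain ⟨w, rfl⟩ := chartDeriv_surjective p hy v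
  have key : ∀ z : E, z = y → P ((extChartAt 𝓘(𝕜, E) p).symm z) (chartDeriv 𝕜 p z w) := by
    rintro z rfl
    exact hv
  have h := key _ ((extChartAt 𝓘(𝕜, E) p).right_inv hy)
  rwa [← mfderiv_extChartAt_chartDeriv p hy w] at h

theorem fderiv_extChartAt_comp {E' : Type*} [NormedAddCommGroup E'] [NormedSpace 𝕜 E'] (p : M)
    {h : E' → M} {y : E'} (hh : MDifferentiableAt 𝓘(𝕜, E') 𝓘(𝕜, E) h y)
    (hy : h y ∈ (extChartAt 𝓘(𝕜, E) p).source) (v : E') :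
    fderiv 𝕜 (fun z => extChartAt 𝓘(𝕜, E) p (h z)) y v =
      mfderiv 𝓘(𝕜, E) 𝓘(𝕜, E) (extChartAt 𝓘(𝕜, E) p) (h y)
        (mfderiv 𝓘(𝕜, E') 𝓘(𝕜, E) h y v) := by
  rw [extChartAt_source] at hy
  have h1 := mfderiv_comp y (mdifferentiableAt_extChartAt (I := 𝓘(𝕜, E)) hy) hh
  rw [mfderiv_eq_fderiv] at h1
  exact congrArg (fun L => L v) h1

/-- Naturality of the bracket under pullback by the inverse chart, where the pulled back fields are
the chart expressions. -/
theorem mlieBracket_extChartAt_symm [CompleteSpace E] [IsManifold 𝓘(𝕜, E) 3 M] (p : M)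
    {V W : ∀ x : M, TangentSpace 𝓘(𝕜, E) x} {y : E} (hy : y ∈ (extChartAt 𝓘(𝕜, E) p).target)
    (hV : MDifferentiableAt 𝓘(𝕜, E) 𝓘(𝕜, E).tangent
      (fun x => (⟨x, V x⟩ : TangentBundle 𝓘(𝕜, E) M)) ((extChartAt 𝓘(𝕜, E) p).symm y))
    (hW : MDifferentiableAt 𝓘(𝕜, E) 𝓘(𝕜, E).tangent
      (fun x => (⟨x, W x⟩ : TangentBundle 𝓘(𝕜, E) M)) ((extChartAt 𝓘(𝕜, E) p).symm y)) :
    VectorField.mlieBracket 𝓘(𝕜, E) V W ((extChartAt 𝓘(𝕜, E) p).symm y) =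
      chartDeriv 𝕜 p y (VectorField.lieBracket 𝕜 (chartField p V) (chartField p W) y) := by
  have : IsManifold 𝓘(𝕜, E) (minSmoothness 𝕜 3) M := by simpa using ‹IsManifold 𝓘(𝕜, E) 3 M›
  have hsymm : ContMDiffAt 𝓘(𝕜, E) 𝓘(𝕜, E) 3 (extChartAt 𝓘(𝕜, E) p).symm y :=
    (contMDiffOn_extChartAt_symm p).contMDiffAt ((isOpen_extChartAt_target p).mem_nhds hy)
  have hpull : ∀ U : (∀ x : M, TangentSpace 𝓘(𝕜, E) x),
      (VectorField.mpullback 𝓘(𝕜, E) 𝓘(𝕜, E) (extChartAt 𝓘(𝕜, E) p).symm U : E → E) =ᶠ[𝓝 y]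
        chartField p U := by
    intro U
    filter_upwards [(isOpen_extChartAt_target p).mem_nhds hy] with z hz
    rw [VectorField.mpullback_apply]
    exact (chartDeriv_isInvertible p hz).inverse_apply_eq.2 (chartDeriv_chartField p U hz).symm
  have h := VectorField.mpullback_mlieBracket hV hW hsymm (by simp; norm_num)
  rw [VectorField.mpullback_apply, (chartDeriv_isInvertible p hy).inverse_apply_eq] at h
  have e : ∀ V' W' : (∀ z : E, TangentSpace 𝓘(𝕜, E) z),
      VectorField.mlieBracket 𝓘(𝕜, E) V' W' y = VectorField.lieBracket 𝕜 V' W' y :=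
    fun V' W' => (congrFun VectorField.mlieBracketWithin_univ y).symm.trans
      ((congrFun VectorField.mlieBracketWithin_eq_lieBracketWithin y).trans
        (congrFun VectorField.lieBracketWithin_univ y))
  exact h.trans (congrArg (chartDeriv 𝕜 p y)
    ((e _ _).trans ((hpull V).lieBracket_vectorField_eq (hpull W))))

end Chart

/-! ### A smooth section of the null line field -/

section NullField

variable {E : Type*} [NormedAddCommGroup E] [NormedSpace ℝ E]

/-- Differentiating `g(k, w) = 0` along `k` gives `g(∇_k k, w) = -g(k, ∇_k w)`; differentiating
`g(k, k) = 0` along `w` gives `g(k, ∇_w k) = 0`. Torsion-freeness turns the difference of the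
right-hand derivatives into the bracket. -/
theorem christoffel_null_field {G : E → E →L[ℝ] E →L[ℝ] ℝ} {k w : E → E} {y : E}
    (hG : DifferentiableAt ℝ G y) (hk : DifferentiableAt ℝ k y) (hw : DifferentiableAt ℝ w y)
    (hsymm : ∀ x u v, G x u v = G x v u) (hkk : ∀ᶠ z in 𝓝 y, G z (k z) (k z) = 0)
    (hkw : ∀ᶠ z in 𝓝 y, G z (k z) (w z) = 0) :
    G y (fderiv ℝ k y (k y)) (w y) + christoffel G y (k y) (k y) (w y) =
      -G y (k y) (VectorField.lieBracket ℝ k w y) := by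
  have key : ∀ (v : E → E) (c : E), DifferentiableAt ℝ v y → (∀ᶠ z in 𝓝 y, G z (k z) (v z) = 0) →
      fderiv ℝ G y c (k y) (v y) + G y (fderiv ℝ k y c) (v y) + G y (k y) (fderiv ℝ v y c) = 0 := by
    intro v c hv h
    have h1 := (hG.hasFDerivAt.clm_apply hk.hasFDerivAt).clm_apply hv.hasFDerivAt
    have h2 := h1.congr_of_eventuallyEq (f₁ := fun _ => (0 : ℝ))
      (by filter_upwards [h] with z hz; exact hz.symm)
    have := congrArg (fun L => L c) (h2.unique (hasFDerivAt_const (0 : ℝ) y))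
    simp at this
    linarith
  have e1 := key k (w y) hk hkk
  have e2 := key w (k y) hw hkw
  rw [hsymm y (k y) (fderiv ℝ k y (w y))] at e1
  have e3 := hsymm y (fderiv ℝ k y (w y)) (k y)
  simp only [christoffel, VectorField.lieBracket_eq, map_sub, e3] at e1 ⊢
  linarith

variable [FiniteDimensional ℝ E] {M : Type*} [TopologicalSpace M] [ChartedSpace E M]
  [IsManifold 𝓘(ℝ, E) ∞ M]
  {g : ∀ x : M, TangentSpace 𝓘(ℝ, E) x →L[ℝ] TangentSpace 𝓘(ℝ, E) x →L[ℝ] ℝ}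
  {D : ∀ x : M, Submodule ℂ (ℂ ⊗[ℝ] TangentSpace 𝓘(ℝ, E) x)} {m : ℕ}

instance finiteDimensional_tangentSpace (x : M) : FiniteDimensional ℝ (TangentSpace 𝓘(ℝ, E) x) :=
  inferInstanceAs (FiniteDimensional ℝ E)

omit [FiniteDimensional ℝ E] [IsManifold 𝓘(ℝ, E) ∞ M] in
theorem bilin_nondegenerate {n : WithTop ℕ∞} (hg : IsMetric n g) (x : M) :
    (bilin g x).Nondegenerate :=
  ⟨hg.nondegenerate x, fun w hw => hg.nondegenerate x w fun v => (hg.symm _ _ _).trans (hw v)⟩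

omit [FiniteDimensional ℝ E] in
theorem finrank_of_isComplexDistribution {n : WithTop ℕ∞} (hD : IsComplexDistribution n m D)
    (x : M) : Module.finrank ℂ (D x) = m := by
  obtain ⟨U, A, B, -, hx, -, -, h⟩ := hD x
  obtain ⟨hind, hspan⟩ := h x hx
  rw [hspan, finrank_span_eq_card hind, Fintype.card_fin]

/-- The Gram operator of the vectors `v i`. -/
def gramOperator {ι : Type*} [Fintype ι] (G : E →L[ℝ] E →L[ℝ] ℝ) (v : ι → E) : E →L[ℝ] E →L[ℝ] ℝ :=
  ∑ i, (G (v i)).smulRight (G (v i))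

omit [FiniteDimensional ℝ E] in
theorem gramOperator_apply {ι : Type*} [Fintype ι] (G : E →L[ℝ] E →L[ℝ] ℝ) (v : ι → E) (u : E) :
    gramOperator G v u = ∑ i, G (v i) u • G (v i) := by
  simp [gramOperator]

omit [FiniteDimensional ℝ E] in
-- Evaluating the operator at `u` on `u` itself gives a sum of squares.
theorem gramOperator_eq_zero {ι : Type*} [Fintype ι] {G : E →L[ℝ] E →L[ℝ] ℝ} {v : ι → E} {u : E}
    (h : gramOperator G v u = 0) (i : ι) : G (v i) u = 0 := by
  have h1 : ∑ i, G (v i) u * G (v i) u = 0 := by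
    have := congrArg (fun L => L u) h
    simpa [gramOperator_apply, sum_apply] using this
  rw [Finset.sum_eq_zero_iff_of_nonneg fun i _ => mul_self_nonneg _] at h1
  exact mul_self_eq_zero.1 (h1 i (Finset.mem_univ i))

theorem exists_equiv_of_injective_dual {T : E →L[ℝ] E →L[ℝ] ℝ} (hT : Function.Injective T) :
    ∃ e : E ≃L[ℝ] (E →L[ℝ] ℝ), (e : E →L[ℝ] E →L[ℝ] ℝ) = T := by
  have hdim : Module.finrank ℝ E = Module.finrank ℝ (E →L[ℝ] ℝ) := by
    rw [← LinearEquiv.finrank_eq (LinearMap.toContinuousLinearMap (𝕜 := ℝ) (E := E) (F' := ℝ))]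
    exact (Subspace.dual_finrank_eq).symm
  have : FiniteDimensional ℝ (E →L[ℝ] ℝ) :=
    LinearEquiv.finiteDimensional (LinearMap.toContinuousLinearMap (𝕜 := ℝ) (E := E) (F' := ℝ))
  exact ⟨(LinearEquiv.ofInjectiveOfFinrankEq (T : E →ₗ[ℝ] E →L[ℝ] ℝ) hT hdim).toContinuousLinearEquiv,
    by ext; rfl⟩

theorem one_tmul_chartDeriv_mem (hm : Module.finrank ℝ E = 2 * m) (hg : IsMetric ∞ g)
    (hD : IsComplexDistribution ∞ m D) (hiso : ∀ x, IsIsotropic (bilin g x) (D x)) (p : M)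
    {A B : Fin m → ∀ x : M, TangentSpace 𝓘(ℝ, E) x} {y : E}
    (hy : y ∈ (extChartAt 𝓘(ℝ, E) p).target)
    (hspan : D ((extChartAt 𝓘(ℝ, E) p).symm y) = Submodule.span ℂ (Set.range fun i =>
      complexVector (A i ((extChartAt 𝓘(ℝ, E) p).symm y)) (B i ((extChartAt 𝓘(ℝ, E) p).symm y))))
    {v : E} (hA : ∀ i, inChart g p y v (chartField p (A i) y) = 0)
    (hB : ∀ i, inChart g p y v (chartField p (B i) y) = 0) :
    (1 : ℂ) ⊗ₜ[ℝ] chartDeriv ℝ p y v ∈ D ((extChartAt 𝓘(ℝ, E) p).symm y) := by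
  refine one_tmul_mem_of_frame (β := bilin g _) (hg.symm _) (bilin_nondegenerate hg _) hspan
    (hiso _) ?_ (fun i => ?_) fun i => ?_
  · rw [finrank_of_isComplexDistribution hD]
    exact hm
  · have := hA i
    rwa [inChart_apply, chartDeriv_chartField p _ hy] at this
  · have := hB i
    rwa [inChart_apply, chartDeriv_chartField p _ hy] at this

theorem exists_null_vector (hm : Module.finrank ℝ E = 2 * m) (hg : IsMetric ∞ g)
    (hD : IsComplexDistribution ∞ m D) (hiso : ∀ x, IsIsotropic (bilin g x) (D x))
    (hL : ∀ x, IsLorentzian (bilin g x)) (p : M) {y : E}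
    (hy : y ∈ (extChartAt 𝓘(ℝ, E) p).target) :
    ∃ k ≠ 0, (1 : ℂ) ⊗ₜ[ℝ] chartDeriv ℝ p y k ∈ D ((extChartAt 𝓘(ℝ, E) p).symm y) := by
  obtain ⟨k, hk0, hk⟩ := exists_one_tmul_mem (β := bilin g ((extChartAt 𝓘(ℝ, E) p).symm y))
    (hg.symm _) (hL _) (hiso _) (by rw [finrank_of_isComplexDistribution hD]; exact hm)
  obtain ⟨k, rfl⟩ := chartDeriv_surjective p hy k
  exact ⟨k, fun h => hk0 (by rw [h, map_zero]), hk⟩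

theorem exists_smul_eq_of_mem_chart (hg : IsMetric ∞ g)
    (hiso : ∀ x, IsIsotropic (bilin g x) (D x))
    (hL : ∀ x, IsLorentzian (bilin g x)) (p : M) {y k v : E}
    (hy : y ∈ (extChartAt 𝓘(ℝ, E) p).target) (hk0 : k ≠ 0)
    (hk : (1 : ℂ) ⊗ₜ[ℝ] chartDeriv ℝ p y k ∈ D ((extChartAt 𝓘(ℝ, E) p).symm y))
    (hv : (1 : ℂ) ⊗ₜ[ℝ] chartDeriv ℝ p y v ∈ D ((extChartAt 𝓘(ℝ, E) p).symm y)) :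
    ∃ c : ℝ, c • k = v := by
  obtain ⟨c, hc⟩ := exists_smul_eq_of_one_tmul_mem (β := bilin g _) (hg.symm _) (hL _) (hiso _)
    (fun h => hk0 (chartDeriv_injective p hy (h.trans (map_zero _).symm))) hk hv
  exact ⟨c, chartDeriv_injective p hy (by rw [map_smul, hc])⟩

omit [FiniteDimensional ℝ E] [IsManifold 𝓘(ℝ, E) ∞ M] in
theorem inChart_eq_zero_of_mem (hiso : ∀ x, IsIsotropic (bilin g x) (D x)) (p : M) {y k a b : E}
    (hk : (1 : ℂ) ⊗ₜ[ℝ] chartDeriv ℝ p y k ∈ D ((extChartAt 𝓘(ℝ, E) p).symm y))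
    (hab : complexVector (chartDeriv ℝ p y a) (chartDeriv ℝ p y b) ∈
      D ((extChartAt 𝓘(ℝ, E) p).symm y)) :
    inChart g p y k a = 0 ∧ inChart g p y k b = 0 := by
  have h := orthogonal_of_mem_of_frame (β := bilin g ((extChartAt 𝓘(ℝ, E) p).symm y)) (hiso _) hk hab
  exact h

/-- The real line field contained in a maximal isotropic distribution has a smooth local section. -/
theorem exists_null_field (hm : Module.finrank ℝ E = 2 * m) (hg : IsMetric ∞ g)
    (hD : IsComplexDistribution ∞ m D) (hiso : ∀ x, IsIsotropic (bilin g x) (D x))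
    (hL : ∀ x, IsLorentzian (bilin g x)) (p : M) {U : Set M}
    {A B : Fin m → ∀ x : M, TangentSpace 𝓘(ℝ, E) x} (hU : IsOpen U) (hp : p ∈ U)
    (hA : ∀ i, ContMDiffOn 𝓘(ℝ, E) 𝓘(ℝ, E).tangent ∞
      (fun x => (⟨x, A i x⟩ : TangentBundle 𝓘(ℝ, E) M)) U)
    (hB : ∀ i, ContMDiffOn 𝓘(ℝ, E) 𝓘(ℝ, E).tangent ∞
      (fun x => (⟨x, B i x⟩ : TangentBundle 𝓘(ℝ, E) M)) U)
    (hspan : ∀ x ∈ U, D x = Submodule.span ℂ (Set.range fun i => complexVector (A i x) (B i x))) :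
    ∃ (S : Set E) (k : E → E) (t : E), IsOpen S ∧ extChartAt 𝓘(ℝ, E) p p ∈ S ∧
      S ⊆ (extChartAt 𝓘(ℝ, E) p).target ∩ (extChartAt 𝓘(ℝ, E) p).symm ⁻¹' U ∧
      ContDiffOn ℝ ∞ k S ∧ (∀ y ∈ S, inChart g p y (k y) t = 1) ∧
      ∀ y ∈ S, (1 : ℂ) ⊗ₜ[ℝ] chartDeriv ℝ p y (k y) ∈ D ((extChartAt 𝓘(ℝ, E) p).symm y) := by
  have : IsManifold 𝓘(ℝ, E) (∞ + 1) M := ‹IsManifold 𝓘(ℝ, E) ∞ M›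
  set φ := extChartAt 𝓘(ℝ, E) p with hφ
  set S₀ : Set E := φ.target ∩ φ.symm ⁻¹' U with hS₀
  have hS₀o : IsOpen S₀ := isOpen_chart_preimage p hU
  have hp₀ : φ p ∈ S₀ := ⟨mem_extChartAt_target p, by
    rw [Set.mem_preimage, hφ, extChartAt_to_inv]
    exact hp⟩
  obtain ⟨k₀, hk₀0, hk₀⟩ := exists_null_vector hm hg hD hiso hL p hp₀.1
  -- A constant vector `t` not orthogonal to the null line at `p`, used to normalise the section by
  -- `g(k, t) = 1`.
  obtain ⟨t, ht⟩ : ∃ t, inChart g p (φ p) k₀ t ≠ 0 := by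
    by_contra! h
    exact hk₀0 (nondegenerate_inChart hg p hp₀.1 h)
  -- The Gram operator of the real frame together with `t` has as kernel the real vectors of `D`
  -- orthogonal to `t`, which is zero near `p`.
  let w : E → Option (Fin m ⊕ Fin m) → E := fun y o =>
    o.elim t (Sum.elim (fun i => chartField p (A i) y) (fun i => chartField p (B i) y))
  let Q : E → E →L[ℝ] E →L[ℝ] ℝ := fun y => gramOperator (inChart g p y) (w y)
  have hG : ContDiffOn ℝ ∞ (inChart g p) S₀ := (hg.contDiffOn p).mono Set.inter_subset_left
  have hQ : ContDiffOn ℝ ∞ Q S₀ := by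
    have hw : ∀ o, ContDiffOn ℝ ∞ (fun y => w y o) S₀ := by
      rintro (_ | i | i)
      · exact contDiffOn_const
      · exact contDiffOn_chartField p hU (hA i)
      · exact contDiffOn_chartField p hU (hB i)
    exact ContDiffOn.sum fun o _ => (hG.clm_apply (hw o)).smulRight (hG.clm_apply (hw o))
  have hmem : ∀ y ∈ S₀, ∀ v, Q y v = 0 → inChart g p y v t = 0 ∧
      (1 : ℂ) ⊗ₜ[ℝ] chartDeriv ℝ p y v ∈ D (φ.symm y) := by
    intro y hy v hv
    have h := gramOperator_eq_zero hv
    have hs := inChart_symm hg p y v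
    exact ⟨(hs _).trans (h none), one_tmul_chartDeriv_mem hm hg hD hiso p hy.1 (hspan _ hy.2)
      (fun i => (hs _).trans (h (some (.inl i)))) fun i => (hs _).trans (h (some (.inr i)))⟩
  -- A real vector of `D` is orthogonal to the whole frame, so only the `t` term survives.
  have hframe : ∀ y ∈ S₀, ∀ k, (1 : ℂ) ⊗ₜ[ℝ] chartDeriv ℝ p y k ∈ D (φ.symm y) →
      Q y k = inChart g p y k t • inChart g p y t := by
    intro y hy k hk
    have h0 : ∀ i, inChart g p y k (chartField p (A i) y) = 0 ∧
        inChart g p y k (chartField p (B i) y) = 0 := by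
      intro i
      refine inChart_eq_zero_of_mem hiso p hk ?_
      rw [chartDeriv_chartField p _ hy.1, chartDeriv_chartField p _ hy.1, hspan _ hy.2]
      exact Submodule.subset_span ⟨i, rfl⟩
    simp only [Q, gramOperator_apply, Fintype.sum_option, Fintype.sum_sum_type, w, Option.elim,
      Sum.elim_inl, Sum.elim_inr]
    simp [inChart_symm hg p y _ k, h0]
  have hinj : Function.Injective (Q (φ p)) := by
    rw [injective_iff_map_eq_zero]
    intro v hv
    obtain ⟨h1, h2⟩ := hmem _ hp₀ v hv
    obtain ⟨c, rfl⟩ := exists_smul_eq_of_mem_chart hg hiso hL p hp₀.1 hk₀0 hk₀ h2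
    have : c = 0 := by simpa [ht] using h1
    simp [this]
  let S : Set E := S₀ ∩ Q ⁻¹' Set.range ((↑) : (E ≃L[ℝ] (E →L[ℝ] ℝ)) → E →L[ℝ] E →L[ℝ] ℝ)
  have hSo : IsOpen S := hQ.continuousOn.isOpen_inter_preimage hS₀o ContinuousLinearEquiv.isOpen
  -- By `hframe` the solution of `Q k = g(t, ·)` is the null vector with `g(k, t) = 1`; smoothness
  -- follows from that of operator inversion.
  refine ⟨S, fun y => (Q y).inverse (inChart g p y t), t, hSo,
    ⟨hp₀, exists_equiv_of_injective_dual hinj⟩, Set.inter_subset_left, ?_, ?_⟩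
  · intro y hy
    obtain ⟨e, he⟩ := hy.2
    have h1 : ContDiffAt ℝ ∞ ContinuousLinearMap.inverse (Q y) := he ▸ contDiffAt_map_inverse e
    exact (h1.comp_contDiffWithinAt y ((hQ y hy.1).mono Set.inter_subset_left)).clm_apply
      (((hG y hy.1).mono Set.inter_subset_left).clm_apply contDiffWithinAt_const)
  · have key : ∀ y ∈ S, inChart g p y ((Q y).inverse (inChart g p y t)) t = 1 ∧
        (1 : ℂ) ⊗ₜ[ℝ] chartDeriv ℝ p y ((Q y).inverse (inChart g p y t)) ∈ D (φ.symm y) := by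
      intro y hy
      obtain ⟨k, hk0, hk⟩ := exists_null_vector hm hg hD hiso hL p hy.1.1
      obtain ⟨e, he⟩ := hy.2
      have hQk := hframe y hy.1 k hk
      have hkt : inChart g p y k t ≠ 0 := by
        intro h
        rw [h, zero_smul, ← he] at hQk
        exact hk0 (e.injective (hQk.trans (map_zero e).symm))
      have hinv : (Q y).inverse (inChart g p y t) = (inChart g p y k t)⁻¹ • k := by
        rw [← he, ContinuousLinearMap.inverse_equiv]
        apply e.injective
        have h2 : e k = inChart g p y k t • inChart g p y t := by rw [← hQk, ← he]; rfl
        rw [map_smul, h2, smul_smul, inv_mul_cancel₀ hkt, one_smul]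
        exact e.apply_symm_apply _
      rw [hinv]
      refine ⟨by simp [hkt], ?_⟩
      rw [map_smul, TensorProduct.tmul_smul]
      exact (D (φ.symm y)).smul_of_tower_mem _ hk
    exact ⟨fun y hy => (key y hy).1, fun y hy => (key y hy).2⟩

end NullField

/-! ### The null congruence and its geodesics -/

section Lorentzian

variable {E : Type*} [NormedAddCommGroup E] [NormedSpace ℝ E] [FiniteDimensional ℝ E]
  {M : Type*} [TopologicalSpace M] [ChartedSpace E M] [IsManifold 𝓘(ℝ, E) ∞ M]
  {g : ∀ x : M, TangentSpace 𝓘(ℝ, E) x →L[ℝ] TangentSpace 𝓘(ℝ, E) x →L[ℝ] ℝ}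
  {D : ∀ x : M, Submodule ℂ (ℂ ⊗[ℝ] TangentSpace 𝓘(ℝ, E) x)} {m : ℕ}

/-- In Lorentzian signature a maximal isotropic distribution meets its conjugate in a line bundle
spanned by a real null vector field. -/
theorem exists_null_section (hm : Module.finrank ℝ E = 2 * m) (hg : IsMetric ∞ g)
    (hD : IsComplexDistribution ∞ m D) (hiso : ∀ x, IsIsotropic (bilin g x) (D x))
    (hL : ∀ x, IsLorentzian (bilin g x)) (p : M) :
    ∃ (U : Set M) (k : ∀ x : M, TangentSpace 𝓘(ℝ, E) x), IsOpen U ∧ p ∈ U ∧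
      ContMDiffOn 𝓘(ℝ, E) 𝓘(ℝ, E).tangent ∞
        (fun x => (⟨x, k x⟩ : TangentBundle 𝓘(ℝ, E) M)) U ∧
      ∀ x ∈ U, k x ≠ 0 ∧ g x (k x) (k x) = 0 ∧
        D x ⊓ conjugate (D x) = Submodule.span ℂ {(1 : ℂ) ⊗ₜ[ℝ] k x} := by
  have : IsManifold 𝓘(ℝ, E) (∞ + 1) M := ‹IsManifold 𝓘(ℝ, E) ∞ M›
  obtain ⟨U₀, A, B, hU₀, hp, hA, hB, hspan⟩ := hD p
  obtain ⟨S, k, t, hS, hpS, hSU, hk, hkt, hkD⟩ := exists_null_field hm hg hD hiso hL p hU₀ hp hA hB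
    fun x hx => (hspan x hx).2
  refine ⟨_, ofChartField p k,
    (continuousOn_extChartAt p).isOpen_inter_preimage (isOpen_extChartAt_source p) hS,
    ⟨mem_extChartAt_source p, hpS⟩, contMDiffOn_ofChartField p hS hk, ?_⟩
  rintro x ⟨hx, hxS⟩
  obtain ⟨y, hy, rfl⟩ : ∃ y ∈ (extChartAt 𝓘(ℝ, E) p).target, (extChartAt 𝓘(ℝ, E) p).symm y = x :=
    ⟨_, (extChartAt 𝓘(ℝ, E) p).map_source hx, (extChartAt 𝓘(ℝ, E) p).left_inv hx⟩
  rw [Set.mem_preimage, (extChartAt 𝓘(ℝ, E) p).right_inv hy] at hxS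
  rw [ofChartField_symm p k hy]
  have hk0 : chartDeriv ℝ p y (k y) ≠ 0 := by
    intro h
    have h1 := hkt y hxS
    rw [chartDeriv_injective p hy (h.trans (map_zero _).symm)] at h1
    simp at h1
  have hmem := hkD y hxS
  refine ⟨hk0, ?_, ?_⟩
  · have hmem' := hmem
    rw [one_tmul_eq_complexVector] at hmem'
    have h := (orthogonal_of_mem_of_frame (β := bilin g ((extChartAt 𝓘(ℝ, E) p).symm y)) (hiso _)
      hmem hmem').1
    exact h
  · exact inf_conjugate_eq_span (β := bilin g ((extChartAt 𝓘(ℝ, E) p).symm y)) (hg.symm _) (hL _)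
      (hiso _) hk0 hmem

/-- The covariant derivative of a real vector field in an integrable maximal isotropic distribution
along itself is proportional to the vector field. -/
theorem exists_acceleration_null_field (hm : Module.finrank ℝ E = 2 * m) (hg : IsMetric ∞ g)
    (hD : IsComplexDistribution ∞ m D) (hiso : ∀ x, IsIsotropic (bilin g x) (D x))
    (hint : IsIntegrable D) (hL : ∀ x, IsLorentzian (bilin g x)) (p : M) {U : Set M}
    {A B : Fin m → ∀ x : M, TangentSpace 𝓘(ℝ, E) x} (hU : IsOpen U)
    (hA : ∀ i, ContMDiffOn 𝓘(ℝ, E) 𝓘(ℝ, E).tangent ∞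
      (fun x => (⟨x, A i x⟩ : TangentBundle 𝓘(ℝ, E) M)) U)
    (hB : ∀ i, ContMDiffOn 𝓘(ℝ, E) 𝓘(ℝ, E).tangent ∞
      (fun x => (⟨x, B i x⟩ : TangentBundle 𝓘(ℝ, E) M)) U)
    (hspan : ∀ x ∈ U, D x = Submodule.span ℂ (Set.range fun i => complexVector (A i x) (B i x)))
    {S : Set E} {k : E → E} (hS : IsOpen S)
    (hSU : S ⊆ (extChartAt 𝓘(ℝ, E) p).target ∩ (extChartAt 𝓘(ℝ, E) p).symm ⁻¹' U)
    (hk : ContDiffOn ℝ ∞ k S)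
    (hkD : ∀ y ∈ S, (1 : ℂ) ⊗ₜ[ℝ] chartDeriv ℝ p y (k y) ∈ D ((extChartAt 𝓘(ℝ, E) p).symm y))
    {y : E} (hy : y ∈ S) (hky : k y ≠ 0) :
    ∃ c : ℝ, ∀ w, inChart g p y (fderiv ℝ k y (k y)) w +
      christoffel (inChart g p) y (k y) (k y) w = c * inChart g p y (k y) w := by
  have : IsManifold 𝓘(ℝ, E) (∞ + 1) M := ‹IsManifold 𝓘(ℝ, E) ∞ M›
  have : IsManifold 𝓘(ℝ, E) 3 M := IsManifold.of_le (n := ∞) (WithTop.coe_le_coe.2 le_top)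
  set φ := extChartAt 𝓘(ℝ, E) p with hφ
  have hyt := (hSU hy).1
  have hyU := (hSU hy).2
  have hSy : S ∈ 𝓝 y := hS.mem_nhds hy
  have hGd : DifferentiableAt ℝ (inChart g p) y :=
    ((hg.contDiffOn p).contDiffAt ((isOpen_extChartAt_target p).mem_nhds hyt)).differentiableAt
      (by simp)
  have hkd : DifferentiableAt ℝ k y := (hk.contDiffAt hSy).differentiableAt (by simp)
  -- the domain of the local sections
  set U' : Set M := U ∩ (φ.source ∩ φ ⁻¹' S) with hU'
  have hU'o : IsOpen U' :=
    hU.inter ((continuousOn_extChartAt p).isOpen_inter_preimage (isOpen_extChartAt_source p) hS)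
  have hxU' : φ.symm y ∈ U' := ⟨hyU, φ.map_target hyt, by
    rw [Set.mem_preimage, φ.right_inv hyt]
    exact hy⟩
  have hK : ContMDiffOn 𝓘(ℝ, E) 𝓘(ℝ, E).tangent ∞
      (fun x => (⟨x, ofChartField p k x⟩ : TangentBundle 𝓘(ℝ, E) M)) U' :=
    (contMDiffOn_ofChartField p hS hk).mono Set.inter_subset_right
  have hKD : ∀ x ∈ U', (1 : ℂ) ⊗ₜ[ℝ] ofChartField p k x ∈ D x := by
    rintro x ⟨-, hx, hxS⟩
    obtain ⟨z, hz, rfl⟩ : ∃ z ∈ φ.target, φ.symm z = x :=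
      ⟨_, φ.map_source hx, φ.left_inv hx⟩
    rw [Set.mem_preimage, φ.right_inv hz] at hxS
    rw [ofChartField_symm p k hz]
    exact hkD z hxS
  have hmd : ∀ {V : ∀ x : M, TangentSpace 𝓘(ℝ, E) x},
      ContMDiffOn 𝓘(ℝ, E) 𝓘(ℝ, E).tangent ∞
        (fun x => (⟨x, V x⟩ : TangentBundle 𝓘(ℝ, E) M)) U' →
      MDifferentiableAt 𝓘(ℝ, E) 𝓘(ℝ, E).tangent
        (fun x => (⟨x, V x⟩ : TangentBundle 𝓘(ℝ, E) M)) (φ.symm y) := fun hV =>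
    (hV.contMDiffAt (hU'o.mem_nhds hxU')).mdifferentiableAt (by simp)
  have hchart : chartField (𝕜 := ℝ) p (ofChartField p k) =ᶠ[𝓝 y] k := by
    filter_upwards [hSy] with z hz
    unfold chartField
    rw [ofChartField_symm p k (hSU hz).1]
    exact mfderiv_extChartAt_chartDeriv p (hSU hz).1 _
  have hbr : ∀ {V : ∀ x : M, TangentSpace 𝓘(ℝ, E) x},
      ContMDiffOn 𝓘(ℝ, E) 𝓘(ℝ, E).tangent ∞
        (fun x => (⟨x, V x⟩ : TangentBundle 𝓘(ℝ, E) M)) U' →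
      VectorField.mlieBracket 𝓘(ℝ, E) (ofChartField p k) V (φ.symm y) =
        chartDeriv ℝ p y (VectorField.lieBracket ℝ k (chartField p V) y) := fun {V} hV => by
    rw [mlieBracket_extChartAt_symm p hyt (hmd hK) (hmd hV),
      hchart.lieBracket_vectorField_eq Filter.EventuallyEq.rfl]
  have hA' := fun i => (hA i).mono (Set.inter_subset_left : U' ⊆ U)
  have hB' := fun i => (hB i).mono (Set.inter_subset_left : U' ⊆ U)
  have hzero : ContMDiffOn 𝓘(ℝ, E) 𝓘(ℝ, E).tangent ∞
      (fun x => (⟨x, 0⟩ : TangentBundle 𝓘(ℝ, E) M)) U' :=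
    (Bundle.contMDiff_zeroSection ℝ (TangentSpace 𝓘(ℝ, E) : M → Type _)).contMDiffOn
  have hframe : ∀ z ∈ S, ∀ i, complexVector (chartDeriv ℝ p z (chartField p (A i) z))
      (chartDeriv ℝ p z (chartField p (B i) z)) ∈ D (φ.symm z) := by
    intro z hz i
    rw [chartDeriv_chartField p _ (hSU hz).1, chartDeriv_chartField p _ (hSU hz).1,
      hspan _ (hSU hz).2]
    exact Submodule.subset_span ⟨i, rfl⟩
  -- Integrability for the sections `k + i0` and `A i + √-1 B i`: the bracket has parts `[k, A i]`
  -- and `[k, B i]`, both orthogonal to `k` by isotropy.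
  have hbracket : ∀ i, inChart g p y (k y) (VectorField.lieBracket ℝ k (chartField p (A i)) y) = 0 ∧
      inChart g p y (k y) (VectorField.lieBracket ℝ k (chartField p (B i)) y) = 0 := by
    intro i
    have h := hint U' (ofChartField p k) 0 (A i) (B i) hU'o (by
      intro V hV
      simp only [List.mem_cons, List.not_mem_nil, or_false] at hV
      rcases hV with rfl | rfl | rfl | rfl
      exacts [hK, hzero, hA' i, hB' i]) (fun x hx => by
        refine ⟨?_, ?_⟩
        · have := hKD x hx
          rwa [one_tmul_eq_complexVector] at this
        · rw [hspan x hx.1]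
          exact Submodule.subset_span ⟨i, rfl⟩) (φ.symm y) hxU'
    rw [VectorField.mlieBracket_zero_left, VectorField.mlieBracket_zero_left, hbr (hA' i),
      hbr (hB' i)] at h
    change complexVector (_ - (0 : TangentSpace 𝓘(ℝ, E) (φ.symm y)))
      (_ + (0 : TangentSpace 𝓘(ℝ, E) (φ.symm y))) ∈ _ at h
    rw [sub_zero, add_zero] at h
    exact inChart_eq_zero_of_mem hiso p (hkD y hy) h
  -- the covariant derivative is orthogonal to the frame
  have hkk : ∀ᶠ z in 𝓝 y, inChart g p z (k z) (k z) = 0 := by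
    filter_upwards [hSy] with z hz
    have h := hkD z hz
    have h' := h
    rw [one_tmul_eq_complexVector, ← map_zero (chartDeriv ℝ p z)] at h'
    exact (inChart_eq_zero_of_mem hiso p h h').1
  have hzeroA : ∀ i, inChart g p y (fderiv ℝ k y (k y)) (chartField p (A i) y) +
      christoffel (inChart g p) y (k y) (k y) (chartField p (A i) y) = 0 := by
    intro i
    rw [christoffel_null_field hGd hkd (((contDiffOn_chartField p hU (hA i)).contDiffAt
      ((isOpen_chart_preimage p hU).mem_nhds (hSU hy))).differentiableAt (by simp))
      (inChart_symm hg p) hkk (by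
        filter_upwards [hSy] with z hz
        exact (inChart_eq_zero_of_mem hiso p (hkD z hz) (hframe z hz i)).1), (hbracket i).1, neg_zero]
  have hzeroB : ∀ i, inChart g p y (fderiv ℝ k y (k y)) (chartField p (B i) y) +
      christoffel (inChart g p) y (k y) (k y) (chartField p (B i) y) = 0 := by
    intro i
    rw [christoffel_null_field hGd hkd (((contDiffOn_chartField p hU (hB i)).contDiffAt
      ((isOpen_chart_preimage p hU).mem_nhds (hSU hy))).differentiableAt (by simp))
      (inChart_symm hg p) hkk (by
        filter_upwards [hSy] with z hz
        exact (inChart_eq_zero_of_mem hiso p (hkD z hz) (hframe z hz i)).2), (hbracket i).2, neg_zero]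
  have hinj : Function.Injective (inChart g p y) := by
    rw [injective_iff_map_eq_zero]
    intro v hv
    exact nondegenerate_inChart hg p hyt fun w => by rw [hv]; rfl
  obtain ⟨e, he⟩ := exists_equiv_of_injective_dual hinj
  -- `κ` is the form `g(∇_k k, ·)`, so `e.symm κ` is `∇_k k`. It is orthogonal to the real frame,
  -- hence a real vector of `D`, hence a multiple of `k`.
  set κ : E →L[ℝ] ℝ := inChart g p y (fderiv ℝ k y (k y)) +
    christoffelForm (inChart g p) y (k y) (k y) with hκ
  have hn : ∀ w, inChart g p y (e.symm κ) w = inChart g p y (fderiv ℝ k y (k y)) w +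
      christoffel (inChart g p) y (k y) (k y) w := by
    intro w
    have h1 : inChart g p y (e.symm κ) = e (e.symm κ) := by rw [← he]; rfl
    rw [h1, e.apply_symm_apply, hκ, add_apply, christoffelForm_apply]
  obtain ⟨c, hc⟩ := exists_smul_eq_of_mem_chart hg hiso hL p hyt hky (hkD y hy)
    (one_tmul_chartDeriv_mem hm hg hD hiso p hyt (hspan _ hyU)
      (fun i => (hn _).trans (hzeroA i)) fun i => (hn _).trans (hzeroB i))
  refine ⟨c, fun w => ?_⟩
  rw [← hn, ← hc]
  simp

/-- The integral curves of the null line field are geodesics up to parametrisation. -/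
theorem isUnparametrizedGeodesicAt_of_mem (hm : Module.finrank ℝ E = 2 * m) (hg : IsMetric ∞ g)
    (hD : IsComplexDistribution ∞ m D) (hiso : ∀ x, IsIsotropic (bilin g x) (D x))
    (hint : IsIntegrable D) (hL : ∀ x, IsLorentzian (bilin g x)) {γ : ℝ → M} {t₀ : ℝ}
    (hγ : ContMDiffAt 𝓘(ℝ, ℝ) 𝓘(ℝ, E) 2 γ t₀) (hγ0 : mfderiv 𝓘(ℝ, ℝ) 𝓘(ℝ, E) γ t₀ ≠ 0)
    (hγD : ∀ᶠ t in 𝓝 t₀, (1 : ℂ) ⊗ₜ[ℝ] mfderiv 𝓘(ℝ, ℝ) 𝓘(ℝ, E) γ t (1 : ℝ) ∈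
      D (γ t) ⊓ conjugate (D (γ t))) : IsUnparametrizedGeodesicAt g γ t₀ := by
  have : IsManifold 𝓘(ℝ, E) 2 M := IsManifold.of_le (n := ∞) (WithTop.coe_le_coe.2 le_top)
  refine ⟨hγ, hγ0, ?_⟩
  obtain ⟨U, A, B, hU, hp, hA, hB, hspan⟩ := hD (γ t₀)
  obtain ⟨S, k, w, hS, hpS, hSU, hk, hkw, hkD⟩ := exists_null_field hm hg hD hiso hL (γ t₀) hU hp
    hA hB fun x hx => (hspan x hx).2
  set p := γ t₀ with hpdef
  set φ := extChartAt 𝓘(ℝ, E) p with hφ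
  set c : ℝ → E := fun s => φ (γ s) with hcdef
  have hc : ContDiffAt ℝ 2 c t₀ := by
    exact ((contMDiffAt_extChartAt (I := 𝓘(ℝ, E)) (x := p)).comp t₀ hγ).contDiffAt
  have hcev := hc.eventually (by norm_num)
  have hcS : ∀ᶠ t in 𝓝 t₀, c t ∈ S := hc.continuousAt.eventually_mem (hS.mem_nhds hpS)
  have hderiv : ∀ᶠ t in 𝓝 t₀, γ t ∈ φ.source ∧
      deriv c t = mfderiv 𝓘(ℝ, E) 𝓘(ℝ, E) φ (γ t) (mfderiv 𝓘(ℝ, ℝ) 𝓘(ℝ, E) γ t (1 : ℝ)) := by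
    filter_upwards [(contMDiffAt_iff_contMDiffAt_nhds (by norm_num)).1 hγ,
      hγ.continuousAt.eventually_mem (extChartAt_source_mem_nhds (I := 𝓘(ℝ, E)) p)] with t h1 h2
    exact ⟨h2, fderiv_extChartAt_comp p (h1.mdifferentiableAt (by norm_num)) h2 (1 : ℝ)⟩
  have hmem : ∀ᶠ t in 𝓝 t₀, (1 : ℂ) ⊗ₜ[ℝ] chartDeriv ℝ p (c t) (deriv c t) ∈ D (φ.symm (c t)) := by
    filter_upwards [hderiv, hγD] with t h1 h2
    rw [h1.2]
    exact mfderiv_comp_extChartAt_pred p h1.1 (fun x v => (1 : ℂ) ⊗ₜ[ℝ] v ∈ D x) h2.1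
  have hne : ∀ᶠ t in 𝓝 t₀, deriv c t ≠ 0 := by
    refine (contDiffAt_deriv hc).continuousAt.eventually_ne ?_
    rw [hderiv.self_of_nhds.2]
    intro h
    have hinv := isInvertible_mfderiv_extChartAt (I := 𝓘(ℝ, E)) (mem_extChartAt_source p)
    have h1 := hinv.injective (h.trans (map_zero _).symm)
    exact hγ0 (by ext; exact h1)
  -- The factor in `c' = f k`, read off by pairing with the normalising vector `w`; this formula
  -- makes its differentiability evident.
  let f : ℝ → ℝ := fun t => inChart g p (c t) (deriv c t) w
  have hcf : ∀ᶠ t in 𝓝 t₀, deriv c t = f t • k (c t) := by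
    filter_upwards [hcS, hmem] with t h1 h2
    have hk0 : k (c t) ≠ 0 := by
      intro h
      have := hkw _ h1
      simp [h] at this
    obtain ⟨r, hr⟩ := exists_smul_eq_of_mem_chart hg hiso hL p (hSU h1).1 hk0 (hkD _ h1) h2
    simp only [f]
    rw [← hr, map_smul, smul_apply, hkw _ h1, smul_eq_mul, mul_one]
  filter_upwards [hcf.eventually_nhds, hcS, hcev, hne] with t h1 h2 h3 h4
  have hyt := (hSU h2).1
  have hk0 : k (c t) ≠ 0 := by
    intro h
    have := hkw _ h2
    simp [h] at this
  obtain ⟨r, hr⟩ := exists_acceleration_null_field hm hg hD hiso hint hL p hU hA hB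
    (fun x hx => (hspan x hx).2) hS hSU hk hkD h2 hk0
  have hc1 : HasDerivAt c (deriv c t) t := (h3.differentiableAt (by norm_num)).hasDerivAt
  have hc2 : HasDerivAt (deriv c) (deriv (deriv c) t) t :=
    ((contDiffAt_deriv h3).differentiableAt (by norm_num)).hasDerivAt
  have hGd : DifferentiableAt ℝ (inChart g p) (c t) :=
    ((hg.contDiffOn p).contDiffAt ((isOpen_extChartAt_target p).mem_nhds hyt)).differentiableAt
      (by simp)
  have hf : DifferentiableAt ℝ f t :=
    ((hGd.comp t hc1.differentiableAt).clm_apply hc2.differentiableAt).clm_apply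
      (differentiableAt_const w)
  have hkd : HasDerivAt (fun s => k (c s)) (fderiv ℝ k (c t) (deriv c t)) t :=
    ((hk.contDiffAt (hS.mem_nhds h2)).differentiableAt (by simp)).hasFDerivAt.comp_hasDerivAt t hc1
  have hdd : deriv (deriv c) t = f t • fderiv ℝ k (c t) (deriv c t) + deriv f t • k (c t) :=
    ((hf.hasDerivAt.smul hkd).congr_of_eventuallyEq h1).deriv
  have hct := h1.self_of_nhds
  have hf0 : f t ≠ 0 := by
    intro h
    rw [h, zero_smul] at hct
    exact h4 hct
  -- With `∇_k k = r k` and `c' = f k`, the acceleration is `(f' + f² r) k`, and `k = c' / f`.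
  refine ⟨(deriv f t + f t ^ 2 * r) / f t, fun v => ?_⟩
  have hrv := hr v
  change inChart g p (c t) (deriv (deriv c) t) v +
    christoffel (inChart g p) (c t) (deriv c t) (deriv c t) v = _ * inChart g p (c t) (deriv c t) v
  rw [hdd, hct]
  simp only [christoffel, map_smul, map_add, add_apply, smul_apply, smul_eq_mul] at hrv ⊢
  field_simp
  linear_combination 2 * f t ^ 2 * hrv

end Lorentzian

/-! ### Identity theorem along a maximally totally real submanifold -/

section IdentityTheorem

variable {E : Type*} [NormedAddCommGroup E] [NormedSpace ℝ E]
  {F : Type*} [NormedAddCommGroup F] [NormedSpace ℂ F]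

/-- A complex basis can be chosen among the values of the differential, and linear independence is
an open condition. -/
theorem eventually_span_range_eq_top [FiniteDimensional ℂ F] {ψ : E → F} {y : E}
    (hψ : ContDiffAt ℝ 1 ψ y) (hspan : Submodule.span ℂ (Set.range (fderiv ℝ ψ y)) = ⊤) :
    ∀ᶠ z in 𝓝 y, Submodule.span ℂ (Set.range (fderiv ℝ ψ z)) = ⊤ := by
  obtain ⟨b, hbs, hb, hind⟩ := exists_linearIndependent ℂ (Set.range (fderiv ℝ ψ y))
  rw [hspan] at hb
  have hfin : Finite b := hind.finite
  have : Fintype b := Fintype.ofFinite b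
  choose u hu using fun i : b => hbs i.2
  have hcard : Fintype.card b = Module.finrank ℂ F := by
    have h := finrank_span_eq_card hind
    rw [Subtype.range_coe, hb, finrank_top] at h
    exact h.symm
  have hcont : ContinuousAt (fun z => fun i : b => fderiv ℝ ψ z (u i)) y :=
    continuousAt_pi.2 fun i =>
      (hψ.fderiv_right (m := 0) (by norm_num)).continuousAt.clm_apply continuousAt_const
  have hmem : (fun i : b => fderiv ℝ ψ y (u i)) ∈ {f : b → F | LinearIndependent ℂ f} := by
    simp only [Set.mem_ofPred_eq, hu]
    exact hind
  filter_upwards [hcont.eventually_mem (isOpen_setOfPred_linearIndependent.mem_nhds hmem)] with z hz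
  have hz' : LinearIndependent ℂ fun i : b => fderiv ℝ ψ z (u i) := hz
  rw [eq_top_iff, ← hz'.span_eq_top_of_card_eq_finrank' hcard]
  refine Submodule.span_mono ?_
  rintro _ ⟨i, rfl⟩
  exact ⟨u i, rfl⟩

/-- A holomorphic function that vanishes on a maximally totally real submanifold vanishes near it. -/
theorem eventually_eq_zero_of_totallyReal [FiniteDimensional ℂ F] {ψ : E → F} {y : E} {h : F → ℂ}
    (hψ : ContDiffAt ℝ 1 ψ y) (hspan : Submodule.span ℂ (Set.range (fderiv ℝ ψ y)) = ⊤)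
    (hh : AnalyticAt ℂ h (ψ y)) (hzero : ∀ᶠ z in 𝓝 y, h (ψ z) = 0) :
    ∀ᶠ z in 𝓝 (ψ y), h z = 0 := by
  have hspan' := eventually_span_range_eq_top hψ hspan
  have hψ' := hψ.eventually (by norm_num)
  have hh' : ∀ᶠ z in 𝓝 y, AnalyticAt ℂ h (ψ z) := hψ.continuousAt.eventually hh.eventually_analyticAt
  -- All complex derivatives vanish along `ψ`: differentiating the `n`-th one along `ψ` kills the
  -- image of `dψ`, and a complex-linear map vanishing there vanishes on its complex span. The
  -- Taylor series at `ψ y` is then zero.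
  have key : ∀ n : ℕ, ∀ᶠ z in 𝓝 y, iteratedFDeriv ℂ n h (ψ z) = 0 := by
    intro n
    induction n with
    | zero =>
      filter_upwards [hzero] with z hz
      ext v
      simpa using hz
    | succ n ih =>
      filter_upwards [ih.eventually_nhds, hspan', hψ', hh'] with z h1 h2 h3 h4
      have hd : DifferentiableAt ℂ (iteratedFDeriv ℂ n h) (ψ z) :=
        (AnalyticAt.contDiffAt (n := ω) h4).differentiableAt_iteratedFDeriv
          (WithTop.coe_lt_top _)
      have hc : HasFDerivAt (fun z => iteratedFDeriv ℂ n h (ψ z))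
          ((fderiv ℂ (iteratedFDeriv ℂ n h) (ψ z)).restrictScalars ℝ ∘L fderiv ℝ ψ z) z :=
        HasFDerivAt.comp z (hd.hasFDerivAt.restrictScalars ℝ)
          (h3.differentiableAt (by norm_num)).hasFDerivAt
      have h0 : HasFDerivAt (fun z => iteratedFDeriv ℂ n h (ψ z))
          (0 : E →L[ℝ] F [×n]→L[ℂ] ℂ) z :=
        (hasFDerivAt_const (0 : F [×n]→L[ℂ] ℂ) z).congr_of_eventuallyEq h1
      have heq := hc.unique h0
      have hker : Submodule.span ℂ (Set.range (fderiv ℝ ψ z)) ≤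
          (fderiv ℂ (iteratedFDeriv ℂ n h) (ψ z)).ker := by
        rw [Submodule.span_le]
        rintro _ ⟨v, rfl⟩
        exact congrArg (fun L => L v) heq
      rw [h2, top_le_iff] at hker
      have hf0 : fderiv ℂ (iteratedFDeriv ℂ n h) (ψ z) = 0 := by
        ext1 v
        have : v ∈ (fderiv ℂ (iteratedFDeriv ℂ n h) (ψ z)).ker := hker ▸ Submodule.mem_top
        exact this
      rw [iteratedFDeriv_succ_eq_comp_left, Function.comp_apply, hf0, map_zero]
  obtain ⟨P, r, hP⟩ := hh
  have hball : Metric.eball (ψ y) r ∈ 𝓝 (ψ y) := Metric.eball_mem_nhds _ hP.r_pos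
  filter_upwards [hball] with z hz
  have hsum := hP.hasSum_iteratedFDeriv (y := z - ψ y) (by
    simpa [edist_eq_enorm_sub] using hz)
  rw [add_sub_cancel] at hsum
  refine hsum.unique ?_
  convert hasSum_zero with n
  simp [(key n).self_of_nhds]

end IdentityTheorem

/-! ### Maps between manifolds in charts -/

section WrittenInChart

variable {𝕜 : Type*} [RCLike 𝕜] {E : Type*} [NormedAddCommGroup E] [NormedSpace 𝕜 E]
  {M : Type*} [TopologicalSpace M] [ChartedSpace E M]
  {E' : Type*} [NormedAddCommGroup E'] [NormedSpace 𝕜 E']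
  {N : Type*} [TopologicalSpace N] [ChartedSpace E' N]

theorem fderiv_writtenInExtChartAt {f : N → M} {q : N}
    (hf : MDifferentiableAt 𝓘(𝕜, E') 𝓘(𝕜, E) f q) (v : E') :
    fderiv 𝕜 (fun y => extChartAt 𝓘(𝕜, E) (f q) (f ((extChartAt 𝓘(𝕜, E') q).symm y)))
      (extChartAt 𝓘(𝕜, E') q q) v = mfderiv 𝓘(𝕜, E') 𝓘(𝕜, E) f q v := by
  have h : fderivWithin 𝕜 (writtenInExtChartAt 𝓘(𝕜, E') 𝓘(𝕜, E) q f) (Set.range 𝓘(𝕜, E'))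
      (extChartAt 𝓘(𝕜, E') q q) = fderiv 𝕜 (writtenInExtChartAt 𝓘(𝕜, E') 𝓘(𝕜, E) q f)
      (extChartAt 𝓘(𝕜, E') q q) := by
    rw [modelWithCornersSelf_coe, Set.range_id, fderivWithin_univ]
  exact congrArg (fun L : E' →L[𝕜] E => L v) (h.symm.trans hf.mfderiv.symm)

theorem contDiffAt_writtenInExtChartAt {n : WithTop ℕ∞} {f : N → M} {q : N}
    (hf : ContMDiffAt 𝓘(𝕜, E') 𝓘(𝕜, E) n f q) :
    ContDiffAt 𝕜 n (fun y => extChartAt 𝓘(𝕜, E) (f q) (f ((extChartAt 𝓘(𝕜, E') q).symm y)))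
      (extChartAt 𝓘(𝕜, E') q q) := by
  have h := (contMDiffAt_iff.1 hf).2
  rw [modelWithCornersSelf_coe, Set.range_id, contDiffWithinAt_univ] at h
  exact h

theorem forall_mem_span_iff {x : M} {m : ℕ} {V : Fin m → TangentSpace 𝓘(𝕜, E) x}
    (G : TangentSpace 𝓘(𝕜, E) x →L[𝕜] TangentSpace 𝓘(𝕜, E) x →L[𝕜] 𝕜) :
    (∀ u ∈ Submodule.span 𝕜 (Set.range V), ∀ v ∈ Submodule.span 𝕜 (Set.range V), G u v = 0) ↔
      ∀ i j, G (V i) (V j) = 0 := by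
  refine ⟨fun h i j => h _ (Submodule.subset_span ⟨i, rfl⟩) _ (Submodule.subset_span ⟨j, rfl⟩),
    fun h u hu v hv => ?_⟩
  induction hu using Submodule.span_induction with
  | mem u hu =>
    obtain ⟨i, rfl⟩ := hu
    induction hv using Submodule.span_induction with
    | mem v hv =>
      obtain ⟨j, rfl⟩ := hv
      exact h i j
    | zero => exact map_zero _
    | add a b _ _ ha hb => rw [map_add, ha, hb, add_zero]
    | smul c a _ ha => rw [map_smul, ha, smul_zero]
  | zero => rw [map_zero]; rfl
  | add a b _ _ ha hb => rw [map_add, add_apply, ha, hb, add_zero]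
  | smul c a _ ha => rw [map_smul, smul_apply, ha, smul_zero]

end WrittenInChart

/-! ### Propagation of isotropy along components -/

section Propagation

variable {F : Type*} [NormedAddCommGroup F] [NormedSpace ℂ F]
  {X : Type*} [TopologicalSpace X] [ChartedSpace F X] [IsManifold 𝓘(ℂ, F) ω X]
  {m : ℕ} {gc : (x : X) → TangentSpace 𝓘(ℂ, F) x →L[ℂ] TangentSpace 𝓘(ℂ, F) x →L[ℂ] ℂ}
  {Dc : (x : X) → Submodule ℂ (TangentSpace 𝓘(ℂ, F) x)}

/-- Locally the distribution `Dc` is isotropic where finitely many holomorphic functions vanish. -/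
theorem exists_isotropic_iff (hgc : IsMetric ω gc) (hDc : IsDistribution ω m Dc) (x₀ : X) :
    ∃ (S : Set F) (h : Fin m → Fin m → F → ℂ), IsOpen S ∧ IsPreconnected S ∧
      extChartAt 𝓘(ℂ, F) x₀ x₀ ∈ S ∧ S ⊆ (extChartAt 𝓘(ℂ, F) x₀).target ∧
      (∀ i j, AnalyticOnNhd ℂ (h i j) S) ∧
      ∀ y ∈ S, (∀ u ∈ Dc ((extChartAt 𝓘(ℂ, F) x₀).symm y),
        ∀ v ∈ Dc ((extChartAt 𝓘(ℂ, F) x₀).symm y),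
          gc ((extChartAt 𝓘(ℂ, F) x₀).symm y) u v = 0) ↔ ∀ i j, h i j y = 0 := by
  have : IsManifold 𝓘(ℂ, F) (ω + 1) X := ‹IsManifold 𝓘(ℂ, F) ω X›
  obtain ⟨U, V, hU, hx₀, hV, hspan⟩ := hDc x₀
  have hS₀ := isOpen_chart_preimage (𝕜 := ℂ) (E := F) x₀ hU
  have hmem : extChartAt 𝓘(ℂ, F) x₀ x₀ ∈
      (extChartAt 𝓘(ℂ, F) x₀).target ∩ (extChartAt 𝓘(ℂ, F) x₀).symm ⁻¹' U :=
    ⟨mem_extChartAt_target x₀, by simpa using hx₀⟩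
  -- A ball is convex, hence preconnected, as the identity theorem requires.
  obtain ⟨r, hr, hball⟩ := Metric.isOpen_iff.1 hS₀ _ hmem
  refine ⟨Metric.ball (extChartAt 𝓘(ℂ, F) x₀ x₀) r,
    fun i j y => inChart gc x₀ y (chartField x₀ (V i) y) (chartField x₀ (V j) y),
    Metric.isOpen_ball, (convex_ball _ _).isPreconnected, Metric.mem_ball_self hr,
    fun y hy => (hball hy).1, fun i j y hy => ?_, fun y hy => ?_⟩
  · have hnhds := hS₀.mem_nhds (hball hy)
    have hG : ContDiffAt ℂ ω (inChart gc x₀) y :=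
      (hgc.contDiffOn x₀).contDiffAt ((isOpen_extChartAt_target x₀).mem_nhds (hball hy).1)
    have hF : ∀ i, ContDiffAt ℂ ω (chartField x₀ (V i)) y := fun i =>
      (contDiffOn_chartField x₀ hU (hV i)).contDiffAt hnhds
    exact ((hG.clm_apply (hF i)).clm_apply (hF j)).analyticAt
  · rw [(hspan _ (hball hy).2).2]
    refine (forall_mem_span_iff _).trans (forall_congr' fun i => forall_congr' fun j => ?_)
    beta_reduce
    rw [inChart_apply, chartDeriv_chartField x₀ _ (hball hy).1,
      chartDeriv_chartField x₀ _ (hball hy).1]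

/-- For closedness, the chart ball of `exists_isotropic_iff` around a limit point meets the set; the
defining functions vanish near a point of the ball, hence on all of it. -/
theorem isClopen_setOf_eventually_isotropic (hgc : IsMetric ω gc) (hDc : IsDistribution ω m Dc) :
    IsClopen {x : X | ∀ᶠ x' in 𝓝 x, ∀ u ∈ Dc x', ∀ v ∈ Dc x', gc x' u v = 0} := by
  refine ⟨isClosed_of_closure_subset fun x₀ hx₀ => ?_, isOpen_setOfPred_eventually_nhds⟩
  obtain ⟨S, h, hS, hconn, hmem, hsub, han, hiff⟩ := exists_isotropic_iff hgc hDc x₀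
  set φ := extChartAt 𝓘(ℂ, F) x₀ with hφ
  have hO : IsOpen (φ.source ∩ φ ⁻¹' S) :=
    (continuousOn_extChartAt x₀).isOpen_inter_preimage (isOpen_extChartAt_source x₀) hS
  have hx₀O : x₀ ∈ φ.source ∩ φ ⁻¹' S := ⟨mem_extChartAt_source x₀, hmem⟩
  obtain ⟨x₁, hx₁, hx₁Z⟩ := mem_closure_iff_nhds.1 hx₀ _ (hO.mem_nhds hx₀O)
  have hcont : Filter.Tendsto φ.symm (𝓝 (φ x₁)) (𝓝 x₁) := by
    have := continuousAt_extChartAt_symm'' (I := 𝓘(ℂ, F)) (φ.map_source hx₁.1)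
    rwa [ContinuousAt, φ.left_inv hx₁.1] at this
  have hnear : ∀ᶠ y in 𝓝 (φ x₁), ∀ i j, h i j y = 0 := by
    filter_upwards [hcont.eventually hx₁Z, hS.mem_nhds hx₁.2] with y hy hyS
    exact (hiff y hyS).1 hy
  have hzero : ∀ i j, ∀ y ∈ S, h i j y = 0 := fun i j =>
    (han i j).eqOn_zero_of_preconnected_of_eventuallyEq_zero hconn hx₁.2
      (hnear.mono fun y hy => hy i j)
  filter_upwards [hO.mem_nhds hx₀O] with x hx
  have := (hiff (φ x) hx.2).2 fun i j => hzero i j _ hx.2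
  rwa [φ.left_inv hx.1] at this

end Propagation

/-! ### Isotropy of the extended distribution -/

section Complexification

variable {E : Type*} [NormedAddCommGroup E] [NormedSpace ℝ E]
  {M : Type*} [TopologicalSpace M] [ChartedSpace E M]
  {F : Type*} [NormedAddCommGroup F] [NormedSpace ℂ F]
  {X : Type*} [TopologicalSpace X] [ChartedSpace F X]
  {g : ∀ x : M, TangentSpace 𝓘(ℝ, E) x →L[ℝ] TangentSpace 𝓘(ℝ, E) x →L[ℝ] ℝ}
  {D : ∀ x : M, Submodule ℂ (ℂ ⊗[ℝ] TangentSpace 𝓘(ℝ, E) x)}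
  {ι : M → X} {m : ℕ}
  {gc : (x : X) → TangentSpace 𝓘(ℂ, F) x →L[ℂ] TangentSpace 𝓘(ℂ, F) x →L[ℂ] ℂ}
  {Dc : (x : X) → Submodule ℂ (TangentSpace 𝓘(ℂ, F) x)}

/-- The real differential of a map from a real manifold to a complex manifold. -/
def realDifferential (ι : M → X) (p : M) : E →L[ℝ] F := mfderiv 𝓘(ℝ, E) 𝓘(ℝ, F) ι p

/-- Both sides are complex bilinear and agree on real vectors. -/
theorem extendsMetric_apply (hext : ExtendsMetric ι g gc) (p : M)
    (z w : ℂ ⊗[ℝ] TangentSpace 𝓘(ℝ, E) p) :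
    gc (ι p) (complexDifferential ι p z) (complexDifferential ι p w) =
      (bilin g p).baseChange ℂ z w := by
  rw [← complexVector_rePart_imPart z, ← complexVector_rePart_imPart w, baseChange_complexVector]
  have hI : ∀ v : TangentSpace 𝓘(ℝ, E) p, (Complex.I ⊗ₜ[ℝ] v : ℂ ⊗[ℝ] TangentSpace 𝓘(ℝ, E) p) =
      Complex.I • ((1 : ℂ) ⊗ₜ[ℝ] v) := fun v => by simp [TensorProduct.smul_tmul']
  simp only [complexVector, hI, map_add, map_smul, add_apply, smul_apply, hext p]
  simp only [Complex.ext_iff, bilin]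
  constructor <;> simp <;> ring

theorem span_range_realDifferential (hι : IsComplexification (E := E) (F := F) ι) (p : M) :
    Submodule.span ℂ (Set.range (realDifferential (E := E) (F := F) ι p)) = ⊤ := by
  rw [eq_top_iff]
  rintro z -
  obtain ⟨w, rfl⟩ := (hι.bijective p).2 z
  induction w using TensorProduct.induction_on with
  | zero => rw [map_zero]; exact Submodule.zero_mem _
  | tmul c v => exact Submodule.smul_mem _ c (Submodule.subset_span ⟨v, rfl⟩)
  | add a b ha hb => rw [map_add]; exact Submodule.add_mem _ ha hb

theorem finrank_of_isComplexification [FiniteDimensional ℝ E]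
    (hι : IsComplexification (E := E) (F := F) ι) (p : M) :
    Module.finrank ℂ F = Module.finrank ℝ E := by
  have h := (LinearEquiv.ofBijective _ (hι.bijective p)).finrank_eq
  rw [Module.finrank_baseChange] at h
  exact h.symm

theorem isotropic_of_mem_range (hiso : ∀ x, IsIsotropic (bilin g x) (D x))
    (hext : ExtendsMetric ι g gc) (hextD : ExtendsDistribution ι D Dc) (p : M) :
    ∀ u ∈ Dc (ι p), ∀ v ∈ Dc (ι p), gc (ι p) u v = 0 := by
  intro u hu v hv
  rw [hextD p] at hu hv
  obtain ⟨z, hz, rfl⟩ := hu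
  obtain ⟨w, hw, rfl⟩ := hv
  exact (extendsMetric_apply hext p z w).trans (hiso p z hz w hw)

variable [FiniteDimensional ℂ F] [IsManifold 𝓘(ℂ, F) ω X]

/-- The defining functions vanish on the image of `M`, whose tangent spaces span over `ℂ`, so
`eventually_eq_zero_of_totallyReal` applies to each. -/
theorem eventually_isotropic_of_mem_range (hiso : ∀ x, IsIsotropic (bilin g x) (D x))
    (hι : IsComplexification (E := E) (F := F) ι) (hgc : IsMetric ω gc)
    (hext : ExtendsMetric ι g gc) (hDc : IsDistribution ω m Dc)
    (hextD : ExtendsDistribution ι D Dc) (p : M) :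
    ∀ᶠ x in 𝓝 (ι p), ∀ u ∈ Dc x, ∀ v ∈ Dc x, gc x u v = 0 := by
  obtain ⟨S, h, hS, -, hmem, hsub, han, hiff⟩ := exists_isotropic_iff hgc hDc (ι p)
  set φ := extChartAt 𝓘(ℂ, F) (ι p) with hφ
  let ψ : E → F := fun y => φ (ι ((extChartAt 𝓘(ℝ, E) p).symm y))
  let y₀ : E := extChartAt 𝓘(ℝ, E) p p
  have hy₀ : (extChartAt 𝓘(ℝ, E) p).symm y₀ = p := extChartAt_to_inv p
  have hψ₀ : ψ y₀ = φ (ι p) := congrArg (fun q => φ (ι q)) hy₀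
  have hψ : ContDiffAt ℝ 1 ψ y₀ :=
    (contDiffAt_writtenInExtChartAt (𝕜 := ℝ) (hι.analytic p)).of_le le_top
  have hspan : Submodule.span ℂ (Set.range (fderiv ℝ ψ y₀)) = ⊤ := by
    rw [← span_range_realDifferential hι p]
    refine congrArg (fun s => Submodule.span ℂ s) (congrArg Set.range (funext fun v => ?_))
    exact fderiv_writtenInExtChartAt (𝕜 := ℝ) ((hι.analytic p).mdifferentiableAt (by simp)) v
  have hcont : Filter.Tendsto (fun y => ι ((extChartAt 𝓘(ℝ, E) p).symm y)) (𝓝 y₀) (𝓝 (ι p)) := by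
    have := continuousAt_extChartAt_symm (I := 𝓘(ℝ, E)) p
    rw [ContinuousAt, extChartAt_to_inv p] at this
    exact (hι.isEmbedding.continuous.tendsto p).comp this
  have hnear : ∀ᶠ y in 𝓝 y₀, ∀ i j, h i j (ψ y) = 0 := by
    filter_upwards [hcont.eventually_mem (extChartAt_source_mem_nhds (I := 𝓘(ℂ, F)) (ι p)),
      hψ.continuousAt.eventually_mem (hψ₀ ▸ hS.mem_nhds hmem)] with y hy₁ hy₂
    refine (hiff _ hy₂).1 ?_
    have e : φ.symm (ψ y) = ι ((extChartAt 𝓘(ℝ, E) p).symm y) := φ.left_inv hy₁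
    rw [e]
    exact isotropic_of_mem_range hiso hext hextD _
  have hzero : ∀ᶠ z in 𝓝 (φ (ι p)), ∀ i j, h i j z = 0 := by
    simp only [Filter.eventually_all]
    intro i j
    have := eventually_eq_zero_of_totallyReal hψ hspan (han i j _ (hψ₀ ▸ hmem))
      (hnear.mono fun y hy => hy i j)
    rwa [hψ₀] at this
  have hφc : Filter.Tendsto φ (𝓝 (ι p)) (𝓝 (φ (ι p))) := continuousAt_extChartAt (ι p)
  filter_upwards [hφc.eventually hzero, hφc.eventually_mem (hS.mem_nhds hmem),
    extChartAt_source_mem_nhds (I := 𝓘(ℂ, F)) (ι p)] with x h₁ h₂ h₃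
  have := (hiff _ h₂).2 h₁
  rwa [φ.left_inv h₃] at this

theorem isotropic_of_isComplexification (hiso : ∀ x, IsIsotropic (bilin g x) (D x))
    (hι : IsComplexification (E := E) (F := F) ι) (hgc : IsMetric ω gc)
    (hext : ExtendsMetric ι g gc) (hDc : IsDistribution ω m Dc)
    (hextD : ExtendsDistribution ι D Dc) (x : X) : ∀ u ∈ Dc x, ∀ v ∈ Dc x, gc x u v = 0 := by
  obtain ⟨p, hp⟩ := hι.meets x
  have h := (isClopen_setOf_eventually_isotropic hgc hDc).connectedComponent_subset
    (eventually_isotropic_of_mem_range hiso hι hgc hext hDc hextD p)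
  rw [← connectedComponent_eq hp] at h
  exact (h mem_connectedComponent).self_of_nhds

end Complexification

/-! ### Integral surfaces are totally geodesic -/

section IntegralManifold

variable {F : Type*} [NormedAddCommGroup F] [NormedSpace ℂ F]
  {X : Type*} [TopologicalSpace X] [ChartedSpace F X] [IsManifold 𝓘(ℂ, F) ω X]
  {F' : Type*} [NormedAddCommGroup F'] [NormedSpace ℂ F']
  {N : Type*} [TopologicalSpace N] [ChartedSpace F' N]
  {m : ℕ} {gc : (x : X) → TangentSpace 𝓘(ℂ, F) x →L[ℂ] TangentSpace 𝓘(ℂ, F) x →L[ℂ] ℂ}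
  {Dc : (x : X) → Submodule ℂ (TangentSpace 𝓘(ℂ, F) x)} {f : N → X}

theorem finrank_of_isIntegralManifold (hDc : IsDistribution ω m Dc)
    (hf : IsIntegralManifold (E' := F') Dc f) (q : N) : Module.finrank ℂ F' = m := by
  obtain ⟨U, V, -, hq, -, hspan⟩ := hDc (f q)
  obtain ⟨hind, hD⟩ := hspan _ hq
  have h₁ := finrank_span_eq_card hind
  rw [Fintype.card_fin, ← hD, ← hf.range_eq q] at h₁
  exact (LinearMap.finrank_range_of_inj
    (f := (mfderiv 𝓘(ℂ, F') 𝓘(ℂ, F) f q).toLinearMap) (hf.injective q)).symm.trans h₁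

variable [IsManifold 𝓘(ℂ, F') ω N]

theorem eventually_inChart_fderiv_eq_zero (hiso : ∀ x, ∀ u ∈ Dc x, ∀ v ∈ Dc x, gc x u v = 0)
    (hf : IsIntegralManifold (E' := F') Dc f) (q : N) :
    ∀ᶠ z in 𝓝 (extChartAt 𝓘(ℂ, F') q q), ∀ v w : F',
      inChart gc (f q) (extChartAt 𝓘(ℂ, F) (f q) (f ((extChartAt 𝓘(ℂ, F') q).symm z)))
        (fderiv ℂ (fun y => extChartAt 𝓘(ℂ, F) (f q) (f ((extChartAt 𝓘(ℂ, F') q).symm y))) z v)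
        (fderiv ℂ (fun y => extChartAt 𝓘(ℂ, F) (f q) (f ((extChartAt 𝓘(ℂ, F') q).symm y))) z w)
        = 0 := by
  have hcont : Filter.Tendsto (fun y => f ((extChartAt 𝓘(ℂ, F') q).symm y))
      (𝓝 (extChartAt 𝓘(ℂ, F') q q)) (𝓝 (f q)) := by
    have := continuousAt_extChartAt_symm (I := 𝓘(ℂ, F')) q
    rw [ContinuousAt, extChartAt_to_inv q] at this
    exact (hf.contMDiff.continuous.tendsto q).comp this
  filter_upwards [extChartAt_target_mem_nhds (I := 𝓘(ℂ, F')) q,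
    hcont.eventually_mem (extChartAt_source_mem_nhds (I := 𝓘(ℂ, F)) (f q))] with z hz hfz v w
  have hsymm : MDifferentiableAt 𝓘(ℂ, F') 𝓘(ℂ, F') (extChartAt 𝓘(ℂ, F') q).symm z :=
    ((contMDiffOn_extChartAt_symm (n := ω) q).contMDiffAt
      ((isOpen_extChartAt_target q).mem_nhds hz)).mdifferentiableAt (by simp)
  have hfd : MDifferentiableAt 𝓘(ℂ, F') 𝓘(ℂ, F) f ((extChartAt 𝓘(ℂ, F') q).symm z) :=
    (hf.contMDiff _).mdifferentiableAt (by simp)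
  have key : ∀ v : F', chartDeriv ℂ (f q)
      (extChartAt 𝓘(ℂ, F) (f q) (f ((extChartAt 𝓘(ℂ, F') q).symm z)))
      (fderiv ℂ (fun y => extChartAt 𝓘(ℂ, F) (f q) (f ((extChartAt 𝓘(ℂ, F') q).symm y))) z v) ∈
      Dc ((extChartAt 𝓘(ℂ, F) (f q)).symm
        (extChartAt 𝓘(ℂ, F) (f q) (f ((extChartAt 𝓘(ℂ, F') q).symm z)))) := by
    intro v
    have hcomp := mfderiv_comp z hfd hsymm
    have hmem : mfderiv 𝓘(ℂ, F') 𝓘(ℂ, F) (fun y => f ((extChartAt 𝓘(ℂ, F') q).symm y)) z v ∈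
        Dc (f ((extChartAt 𝓘(ℂ, F') q).symm z)) := by
      rw [← hf.range_eq]
      exact ⟨mfderiv 𝓘(ℂ, F') 𝓘(ℂ, F') (extChartAt 𝓘(ℂ, F') q).symm z v,
        (congrArg (fun L => L v) hcomp).symm⟩
    have h := mfderiv_comp_extChartAt_pred (f q) hfz (fun x v => v ∈ Dc x) hmem
    rwa [← fderiv_extChartAt_comp (h := fun y => f ((extChartAt 𝓘(ℂ, F') q).symm y)) (f q)
      (hfd.comp z hsymm) hfz v] at h
  rw [inChart_apply]
  exact hiso _ _ (key v) _ (key w)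

/-- The local statement `exists_lift_of_acceleration_eq_zero` is applied to `f` and `γ` read in the
charts at `q` and `f q`; injectivity of the chart at `f q` on its source brings the equality back to
`X`. -/
theorem isTotallyGeodesic_of_isotropic [FiniteDimensional ℂ F] [FiniteDimensional ℂ F']
    (hgc : IsMetric ω gc) (hF : Module.finrank ℂ F = 2 * m)
    (hDc : IsDistribution ω m Dc) (hiso : ∀ x, ∀ u ∈ Dc x, ∀ v ∈ Dc x, gc x u v = 0)
    (hf : IsIntegralManifold (E' := F') Dc f) : IsTotallyGeodesic (E' := F') gc f := by
  intro γ q u hγ hT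
  have h0 : γ 0 = f q := congrArg Bundle.TotalSpace.proj hT
  have h1 : (mfderiv 𝓘(ℂ, ℂ) 𝓘(ℂ, F) γ 0 (1 : ℂ) : F) = mfderiv 𝓘(ℂ, F') 𝓘(ℂ, F) f q u :=
    congrArg (fun z : TangentBundle 𝓘(ℂ, F) X => (z.2 : F)) hT
  obtain ⟨hγ2, hacc⟩ := hγ
  rw [h0] at hacc
  have hfd : MDifferentiableAt 𝓘(ℂ, F') 𝓘(ℂ, F) f q := (hf.contMDiff q).mdifferentiableAt (by simp)
  have hψ₀ : extChartAt 𝓘(ℂ, F) (f q) (f ((extChartAt 𝓘(ℂ, F') q).symm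
      (extChartAt 𝓘(ℂ, F') q q))) = extChartAt 𝓘(ℂ, F) (f q) (f q) := by
    rw [extChartAt_to_inv q]
  have hψd : ∀ v : F', fderiv ℂ
      (fun y => extChartAt 𝓘(ℂ, F) (f q) (f ((extChartAt 𝓘(ℂ, F') q).symm y)))
      (extChartAt 𝓘(ℂ, F') q q) v = mfderiv 𝓘(ℂ, F') 𝓘(ℂ, F) f q v :=
    fderiv_writtenInExtChartAt hfd
  have hG : ContDiffAt ℂ 2 (inChart gc (f q)) (extChartAt 𝓘(ℂ, F) (f q) (f q)) :=
    ((hgc.contDiffOn (f q)).contDiffAt (extChartAt_target_mem_nhds (f q))).of_le le_top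
  have hx : ContDiffAt ℂ 2 (fun t => extChartAt 𝓘(ℂ, F) (f q) (γ t)) 0 := by
    rw [← h0]
    exact contDiffAt_writtenInExtChartAt hγ2
  have hx1 : deriv (fun t => extChartAt 𝓘(ℂ, F) (f q) (γ t)) 0 =
      mfderiv 𝓘(ℂ, F') 𝓘(ℂ, F) f q u := by
    rw [← h0, ← fderiv_apply_one_eq_deriv]
    exact (fderiv_writtenInExtChartAt (hγ2.mdifferentiableAt (by simp)) (1 : ℂ)).trans h1
  obtain ⟨c, hc, hc0, hcγ⟩ := exists_lift_of_acceleration_eq_zero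
    (ψ := fun y => extChartAt 𝓘(ℂ, F) (f q) (f ((extChartAt 𝓘(ℂ, F') q).symm y)))
    (G := inChart gc (f q)) (y := extChartAt 𝓘(ℂ, F') q q) (u := u)
    (x := fun t => extChartAt 𝓘(ℂ, F) (f q) (γ t))
    (by rw [hF, finrank_of_isIntegralManifold hDc hf q])
    ((contDiffAt_writtenInExtChartAt (hf.contMDiff q)).of_le le_top)
    (fun v w h => hf.injective q ((hψd v).symm.trans (h.trans (hψd w))))
    (by rw [hψ₀]; exact hG)
    (fun y u v => inChart_symm hgc (f q) y u v)
    (fun v hv => by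
      rw [hψ₀] at hv
      exact nondegenerate_inChart hgc (f q) (mem_extChartAt_target (f q)) hv)
    (eventually_inChart_fderiv_eq_zero hiso hf q) hx
    (by rw [hψ₀, h0])
    (hx1.trans (hψd u).symm)
    hacc
  have hcq : (extChartAt 𝓘(ℂ, F') q).symm (c 0) = q := by rw [hc0, extChartAt_to_inv]
  have hsymm : ContMDiffAt 𝓘(ℂ, F') 𝓘(ℂ, F') 2 (extChartAt 𝓘(ℂ, F') q).symm (c 0) := by
    rw [hc0]
    exact ((contMDiffOn_extChartAt_symm (n := ω) q).contMDiffAt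
      (extChartAt_target_mem_nhds q)).of_le le_top
  have hc' : ContMDiffAt 𝓘(ℂ, ℂ) 𝓘(ℂ, F') 2 (fun t => (extChartAt 𝓘(ℂ, F') q).symm (c t)) 0 :=
    hsymm.comp 0 hc.contMDiffAt
  refine ⟨fun t => (extChartAt 𝓘(ℂ, F') q).symm (c t), hcq, hc', ?_⟩
  have hs := extChartAt_source_mem_nhds (I := 𝓘(ℂ, F)) (f q)
  have hfc : ContinuousAt (fun t => f ((extChartAt 𝓘(ℂ, F') q).symm (c t))) 0 :=
    hf.contMDiff.continuous.continuousAt.comp hc'.continuousAt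
  filter_upwards [hcγ, hγ2.continuousAt.eventually_mem (by rwa [h0]),
    hfc.eventually_mem (by rw [hcq]; exact hs)] with t h₁ h₂ h₃
  exact (extChartAt 𝓘(ℂ, F) (f q)).injOn h₃ h₂ h₁

end IntegralManifold

end IsotropicFoliation

end

theorem mainTheorem10
    {E : Type*} [NormedAddCommGroup E] [NormedSpace ℝ E] [FiniteDimensional ℝ E]
    {M : Type*} [TopologicalSpace M] [ChartedSpace E M] [IsManifold 𝓘(ℝ, E) ∞ M]
    (m : ℕ) (hm : Module.finrank ℝ E = 2 * m)
    (g : ∀ x : M, TangentSpace 𝓘(ℝ, E) x →L[ℝ] TangentSpace 𝓘(ℝ, E) x →L[ℝ] ℝ)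
    (hg : IsotropicFoliation.IsMetric ∞ g)
    (D : ∀ x : M, Submodule ℂ (ℂ ⊗[ℝ] TangentSpace 𝓘(ℝ, E) x))
    (hD : IsotropicFoliation.IsComplexDistribution ∞ m D)
    (hiso : ∀ x, IsotropicFoliation.IsIsotropic (IsotropicFoliation.bilin g x) (D x))
    (hint : IsotropicFoliation.IsIntegrable D) :
    -- analytic case: integral surfaces in a complexification are totally geodesic
    (IsManifold 𝓘(ℝ, E) ω M → IsotropicFoliation.IsMetric ω g →
      IsotropicFoliation.IsComplexDistribution ω m D →
      ∀ {F : Type*} [NormedAddCommGroup F] [NormedSpace ℂ F] [FiniteDimensional ℂ F]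
        {X : Type*} [TopologicalSpace X] [ChartedSpace F X] [IsManifold 𝓘(ℂ, F) ω X]
        (ι : M → X), IsotropicFoliation.IsComplexification (E := E) (F := F) ι →
      ∀ gc : (x : X) → TangentSpace 𝓘(ℂ, F) x →L[ℂ] TangentSpace 𝓘(ℂ, F) x →L[ℂ] ℂ,
        IsotropicFoliation.IsMetric ω gc → IsotropicFoliation.ExtendsMetric ι g gc →
      ∀ Dc : (x : X) → Submodule ℂ (TangentSpace 𝓘(ℂ, F) x),
        IsotropicFoliation.IsDistribution ω m Dc →
        IsotropicFoliation.ExtendsDistribution ι D Dc →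
      ∀ {F' : Type*} [NormedAddCommGroup F'] [NormedSpace ℂ F'] [FiniteDimensional ℂ F']
        {N : Type*} [TopologicalSpace N] [ChartedSpace F' N] [IsManifold 𝓘(ℂ, F') ω N]
        (f : N → X), IsotropicFoliation.IsIntegralManifold (E' := F') Dc f →
        IsotropicFoliation.IsTotallyGeodesic (E' := F') gc f) ∧
    -- Lorentzian case: the intersection of `D` with its conjugate is a geodesic null congruence
    ((∀ x, IsotropicFoliation.IsLorentzian (IsotropicFoliation.bilin g x)) →
      (∀ p : M, ∃ (U : Set M) (k : ∀ x : M, TangentSpace 𝓘(ℝ, E) x), IsOpen U ∧ p ∈ U ∧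
        ContMDiffOn 𝓘(ℝ, E) 𝓘(ℝ, E).tangent ∞
          (fun x => (⟨x, k x⟩ : TangentBundle 𝓘(ℝ, E) M)) U ∧
        ∀ x ∈ U, k x ≠ 0 ∧ g x (k x) (k x) = 0 ∧
          D x ⊓ IsotropicFoliation.conjugate (D x) = Submodule.span ℂ {(1 : ℂ) ⊗ₜ[ℝ] k x}) ∧
      ∀ (γ : ℝ → M) (t₀ : ℝ), ContMDiffAt 𝓘(ℝ, ℝ) 𝓘(ℝ, E) 2 γ t₀ →
        mfderiv 𝓘(ℝ, ℝ) 𝓘(ℝ, E) γ t₀ ≠ 0 →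
        (∀ᶠ t in 𝓝 t₀, (1 : ℂ) ⊗ₜ[ℝ] mfderiv 𝓘(ℝ, ℝ) 𝓘(ℝ, E) γ t (1 : ℝ) ∈
          D (γ t) ⊓ IsotropicFoliation.conjugate (D (γ t))) →
        IsotropicFoliation.IsUnparametrizedGeodesicAt g γ t₀) := by
  refine ⟨fun _ _ _ F _ _ _ X _ _ _ ι hι gc hgc hext Dc hDc hextD F' _ _ _ N _ _ _ f hf => ?_,
    fun hL => ⟨IsotropicFoliation.exists_null_section hm hg hD hiso hL,
      fun γ t₀ hγ hγ0 hγD =>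
        IsotropicFoliation.isUnparametrizedGeodesicAt_of_mem hm hg hD hiso hint hL hγ hγ0 hγD⟩⟩
  intro γ q
  -- A point of `M` is needed to compare the dimensions of `F` and `E`; `q` supplies one because
  -- every component of `X` meets `M`.
  obtain ⟨p, -⟩ := hι.meets (f q)
  have hF : Module.finrank ℂ F = 2 * m :=
    (IsotropicFoliation.finrank_of_isComplexification hι p).trans hm
  exact IsotropicFoliation.isTotallyGeodesic_of_isotropic hgc hF hDc
    (IsotropicFoliation.isotropic_of_isComplexification hiso hι hgc hext hDc hextD) hf γ q
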